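/- Fix an integer $k\ge 2$. Define formal series $G_l(q)$, $l\ge 1$, in "shelves": for $1\le i\le k$, $$G_i(q)=\prod_{\substack{m\ge 1,\ m\not\equiv 2\ (\mathrm{mod}\ 4)\\ m\not\equiv 0,\,2k\pm(2i-1)\ (\mathrm{mod}\ 4k)}}(1-q^m)^{-1},$$ and for $j\ge 1$ and $2\le i\le k$, $$G_{(k-1)j+i}(q)=\frac{G_{(k-1)(j-1)+k-i+1}(q)-G_{(k-1)(j-1)+k-i+2}(q)}{q^{2j(i-1)}}-q^{-1}G_{(k-1)j+i-1}(q)$$ (for $i=1$ one has $G_{(k-1)j+1}=G_{(k-1)(j-1)+k}$, since the indices agree). A priori these are formal Laurent series over $\mathbb C$. Let $\mathbf G_{(j)}$ be the column vector with entries $G_{(k-1)j+1},\dots,G_{(k-1)j+k}$. For $j\ge1$ let $\mathbf B_{(j)}$ be the $k\times k$ matrix whose $i$-th row ($1\le i\le k$) has $q^{-2j(i-1)}$ in column $k-i+1$, $-q^{-2j(i-1)}$ in column $k-i+2$ (if $i\ge2$), and zeros elsewhere; let $\mathbf C$ be the $k\times k$ matrix with $1$ on the diagonal, $q^{-1}$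 immediately below the diagonal, and zeros elsewhere. Then $\mathbf B_{(j)}$ is invertible for every $j\ge 1$, and $$\mathbf C\,\mathbf G_{(j)}=\mathbf B_{(j)}\,\mathbf G_{(j-1)}\qquad(j\ge1).$$ Put $\mathbf A'_{(j)}=\mathbf B_{(j)}^{-1}\mathbf C$. For $j\ge J\ge 0$ let ${}^J\mathbf h^{(j)}=\mathbf A'_{(J+1)}\cdots\mathbf A'_{(j)}$ (the identity matrix if $j=J$), and let ${}^J_ih^{(j)}_l(q)$ denote its $(i,l)$ entry. Then for every $J\ge 0$: 1. $\mathbf G_{(J)}={}^J\mathbf h^{(j)}\,\mathbf G_{(j)}$ for all $j\ge J$; 2. for all $j\ge J$ and $1\le i,l\le k$, ${}^J_ih^{(j)}_l(q)$ is a polynomial in $q$ with nonnegative integer coefficients; 3. for every $1\le i\le k$, the coefficientwise limit ${}^J_ih^{(\infty)}_1(q)=\lim_{j\to\infty}{}^J_ih^{(j)}_1(q)$ exists as a formal power series (that is, each coefficient is eventually constant in $j$), and $$G_{(k-1)J+i}(q)={}^J_ih^{(\infty)}_1(q).$$ -/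

import Mathlib

open scoped Matrix Polynomial

namespace GollnitzGordonAndrews

noncomputable section

/-- The monomial `q ^ n` (`n` any integer), as a formal Laurent series over `ℂ`. -/
def qPow (n : ℤ) : LaurentSeries ℂ := HahnSeries.single n 1

/-- `m ≢ 2 (mod 4)` and `m ≢ 0, 2k ± (2i - 1) (mod 4k)`. -/
def AllowedPart (k i m : ℕ) : Prop :=
  ¬ (m : ℤ) ≡ 2 [ZMOD 4] ∧ ¬ (m : ℤ) ≡ 0 [ZMOD 4 * k] ∧
    ¬ (m : ℤ) ≡ 2 * k + (2 * i - 1) [ZMOD 4 * k] ∧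
    ¬ (m : ℤ) ≡ 2 * k - (2 * i - 1) [ZMOD 4 * k]

open Classical in
/-- The factor of index `m + 1` in the infinite product defining the `0`-th shelf. -/
def prodFactor (k i m : ℕ) : PowerSeries ℂ :=
  if AllowedPart k i (m + 1) then (1 - (PowerSeries.X : PowerSeries ℂ) ^ (m + 1))⁻¹ else 1

open scoped PowerSeries.WithPiTopology in
/-- The infinite product `∏ (1 - q ^ m)⁻¹` over the `m ≥ 1` with `m ≢ 2 (mod 4)` and
`m ≢ 0, 2k ± (2i - 1) (mod 4k)`, taken in the topology of coefficientwise convergence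
(it converges, see `multipliable_prodFactor`). -/
def prodSide (k i : ℕ) : PowerSeries ℂ := ∏' m : ℕ, prodFactor k i m

open scoped PowerSeries.WithPiTopology in
theorem multipliable_prodFactor (k i : ℕ) : Multipliable (prodFactor k i) := by
  have h1 : ∀ m : ℕ, (PowerSeries.X : PowerSeries ℂ) ^ (m + 1) ∣ prodFactor k i m - 1 := by
    intro m
    unfold prodFactor
    split_ifs
    · refine ⟨(1 - (PowerSeries.X : PowerSeries ℂ) ^ (m + 1))⁻¹, ?_⟩
      have hne : PowerSeries.constantCoeff (1 - (PowerSeries.X : PowerSeries ℂ) ^ (m + 1)) ≠ 0 := by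
        simp
      have := PowerSeries.mul_inv_cancel _ hne
      linear_combination this
    · simp
  have h2 : prodFactor k i = fun m => 1 + (prodFactor k i m - 1) := by
    funext m
    ring
  rw [h2]
  apply PowerSeries.WithPiTopology.multipliable_one_add_of_tendsto_order_atTop_nhds_top
  rw [ENat.tendsto_nhds_top_iff_natCast_lt]
  intro n
  filter_upwards [Filter.eventually_ge_atTop n] with m hm
  have h3 : ((m + 1 : ℕ) : ℕ∞) ≤ (prodFactor k i m - 1).order :=
    PowerSeries.nat_le_order _ _ (PowerSeries.X_pow_dvd_iff.mp (h1 m))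
  exact lt_of_lt_of_le (by exact_mod_cast Nat.lt_succ_of_le hm) h3

/-- `shelf k j i` is the `i`-th series (`1 ≤ i ≤ k`) of the `j`-th shelf; the value at `i = 0` on
the higher shelves plays no role. The series are constructed inside the formal Laurent series,
since the recursion divides by powers of `q`. -/
def shelf (k : ℕ) : ℕ → ℕ → LaurentSeries ℂ
  | 0, i => (prodSide k i : LaurentSeries ℂ)
  | _ + 1, 0 => 0
  | j + 1, 1 => shelf k j k
  | j + 1, i + 2 =>
      (shelf k j (k - (i + 2) + 1) - shelf k j (k - (i + 2) + 2)) /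
          qPow (2 * (j + 1) * ((i + 2) - 1))
        - qPow (-1) * shelf k (j + 1) (i + 1)
termination_by j i => (j, i)

/-- The sequence `G_l(q)`, `l ≥ 1`: the `l`-th term is the `i`-th series of the `j`-th shelf
whenever `l = (k - 1) j + i` with `1 ≤ i ≤ k` (see `G_eq_shelf`). -/
def G (k l : ℕ) : LaurentSeries ℂ := shelf k ((l - 1) / (k - 1)) ((l - 1) % (k - 1) + 1)

theorem G_eq_shelf (k : ℕ) (hk : 2 ≤ k) (j i : ℕ) (hi : 1 ≤ i) (hik : i ≤ k) :
    G k ((k - 1) * j + i) = shelf k j i := by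
  obtain ⟨n, rfl⟩ : ∃ n, k = n + 2 := ⟨k - 2, by omega⟩
  obtain ⟨t, rfl⟩ : ∃ t, i = t + 1 := ⟨i - 1, by omega⟩
  have e1 : n + 2 - 1 = n + 1 := by omega
  have e2 : (n + 1) * j + (t + 1) - 1 = t + (n + 1) * j := by omega
  unfold G
  rw [e1, e2]
  rcases Nat.lt_or_ge t (n + 1) with h | h
  · rw [Nat.add_mul_div_left _ _ (Nat.succ_pos n), Nat.add_mul_mod_self_left,
      Nat.div_eq_of_lt h, Nat.mod_eq_of_lt h, Nat.zero_add]
  · obtain rfl : t = n + 1 := by omega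
    rw [Nat.add_mul_div_left _ _ (Nat.succ_pos n), Nat.add_mul_mod_self_left,
      Nat.div_self (Nat.succ_pos n), Nat.mod_self, Nat.zero_add, Nat.add_comm 1 j, shelf]

/-- The `0`-th shelf consists of the product sides. -/
theorem G_zero_shelf (k : ℕ) (hk : 2 ≤ k) (i : ℕ) (hi : 1 ≤ i) (hik : i ≤ k) :
    G k i = (prodSide k i : LaurentSeries ℂ) := by
  have h := G_eq_shelf k hk 0 i hi hik
  rw [Nat.mul_zero, Nat.zero_add] at h
  rw [h, shelf]

/-- The recursion defining the higher shelves, in terms of the sequence `G_l(q)`. -/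
theorem G_recursion (k : ℕ) (hk : 2 ≤ k) (j i : ℕ) (hj : 1 ≤ j) (hi : 2 ≤ i) (hik : i ≤ k) :
    G k ((k - 1) * j + i) =
      (G k ((k - 1) * (j - 1) + (k - i + 1)) - G k ((k - 1) * (j - 1) + (k - i + 2))) /
          qPow (2 * j * (i - 1))
        - qPow (-1) * G k ((k - 1) * j + (i - 1)) := by
  rw [G_eq_shelf k hk _ _ (by omega) hik, G_eq_shelf k hk _ _ (by omega) (by omega),
    G_eq_shelf k hk _ _ (by omega) (by omega), G_eq_shelf k hk _ _ (by omega) (by omega)]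
  obtain ⟨j, rfl⟩ : ∃ n, j = n + 1 := ⟨j - 1, by omega⟩
  obtain ⟨i, rfl⟩ : ∃ n, i = n + 2 := ⟨i - 2, by omega⟩
  rw [shelf]
  simp

/-- The column vector `𝐆_(j)` with entries `G_{(k-1)j+1}(q), …, G_{(k-1)j+k}(q)`.
Here and below the index `i : Fin k` stands for the position `i + 1`. -/
def vecG (k j : ℕ) : Fin k → LaurentSeries ℂ := fun i => G k ((k - 1) * j + (i + 1))

/-- The matrix `𝐁_(j)`: row `r + 1` has `q ^ (-2jr)` in column `k - r` and `-q ^ (-2jr)` in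
column `k - r + 1` (if there is such a column), and zeros elsewhere. -/
def matB (k j : ℕ) : Matrix (Fin k) (Fin k) (LaurentSeries ℂ) :=
  Matrix.of fun r c =>
    if (r : ℕ) + c + 1 = k then qPow (-(2 * j * r))
    else if (r : ℕ) + c = k then -qPow (-(2 * j * r))
    else 0

/-- The matrix `𝐂`: ones on the diagonal and `q⁻¹` just below it. -/
def matC (k : ℕ) : Matrix (Fin k) (Fin k) (LaurentSeries ℂ) :=
  Matrix.of fun r c =>
    if r = c then 1 else if (r : ℕ) = c + 1 then qPow (-1) else 0

/-- The matrix `𝐀'_(j) = 𝐀_(j) 𝐂`, where `𝐀_(j) = 𝐁_(j)⁻¹`. -/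
def matA' (k j : ℕ) : Matrix (Fin k) (Fin k) (LaurentSeries ℂ) := (matB k j)⁻¹ * matC k

/-- The matrix `ᴶ𝐡^(j) = 𝐀'_(J+1) ⋯ 𝐀'_(j)` for `j ≥ J`; the empty product (`j = J`) is the
identity matrix. -/
def matH (k J j : ℕ) : Matrix (Fin k) (Fin k) (LaurentSeries ℂ) :=
  ((List.range' (J + 1) (j - J)).map (matA' k)).prod

/-- `L` is the coefficientwise limit of the sequence `H`: each coefficient of `H j` is eventually
constant, equal to the corresponding coefficient of `L`. -/
def IsCoeffLimit (H : ℕ → LaurentSeries ℂ) (L : LaurentSeries ℂ) : Prop :=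
  ∀ n : ℤ, ∃ N : ℕ, ∀ j : ℕ, N ≤ j → (H j).coeff n = L.coeff n

/-- A polynomial with nonnegative integer coefficients, viewed as a formal Laurent series. -/
def natPolyToLaurent (p : ℕ[X]) : LaurentSeries ℂ :=
  (((p.map (Nat.castRingHom ℂ) : ℂ[X]) : PowerSeries ℂ) : LaurentSeries ℂ)

end

end GollnitzGordonAndrews

namespace GollnitzGordonAndrews

/-! ### Congruences modulo powers of `X` -/

/-! The shelves have a closed form. Write k = i + p + 1, so that p counts the positions after
position i + 1. The Jacobi triple product turns shelf 0 into a common product times a theta series,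
which is the case j = 0 of Andrews' J (`prodSide_eq`, `shelfCore_zero`). A telescoping difference
equation for Andrews' H (`shelfSeries_sub`) shows that the J satisfy the shelf recursion, the
exchange of i and p matching its index reversal. Hence every shelf entry is a genuine power series
(`shelf_eq_shelfPS`), and the first entry of shelf j + 1 is 1 modulo q^j
(`X_pow_dvd_shelfPS_sub_one`).

On the matrix side, the inverse of B has monomial or zero entries, and multiplying by C leaves only
polynomials with nonnegative coefficients (`matA'_eq`). For j > J, column l of h^(j), counted from
0, is divisible by q^(2jl). So in G_(J) = h^(j) G_(j) every column but the first dies out as j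
grows, while the first entry of G_(j) tends to 1: the first column of h^(j) tends to G_(J).

Limits are handled as divisibility of differences by powers of X. -/

theorem dvd_mul_sub_mul {R : Type*} [CommRing R] {d a b c e : R} (h1 : d ∣ a - b)
    (h2 : d ∣ c - e) : d ∣ a * c - b * e := by
  have : a * c - b * e = (a - b) * c + b * (c - e) := by ring
  rw [this]
  exact dvd_add (h1.mul_right _) (h2.mul_left _)

theorem dvd_sub_trans {R : Type*} [CommRing R] {d a b c : R} (h1 : d ∣ a - b)
    (h2 : d ∣ b - c) : d ∣ a - c := by
  have := dvd_add h1 h2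
  rwa [sub_add_sub_cancel] at this

theorem dvd_sub_symm {R : Type*} [CommRing R] {d a b : R} (h : d ∣ a - b) : d ∣ b - a :=
  (dvd_sub_comm).mp h

theorem dvd_prod_sub_one {R ι : Type*} [CommRing R] {d : R} (s : Finset ι) (f : ι → R)
    (h : ∀ m ∈ s, d ∣ f m - 1) : d ∣ (∏ m ∈ s, f m) - 1 := by
  classical
  induction s using Finset.induction_on with
  | empty => simp
  | insert a s ha ih =>
    rw [Finset.prod_insert ha]
    have := dvd_mul_sub_mul (h a (by simp)) (ih fun m hm => h m (by simp [hm]))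
    rwa [one_mul] at this

/-- Enlarging a partial product does not change it modulo `d`, if `d` divides `f m - 1` for all
the new indices. -/
theorem dvd_prod_range_sub {R : Type*} [CommRing R] {d : R} (f : ℕ → R) {a b : ℕ} (hab : a ≤ b)
    (h : ∀ m, a ≤ m → d ∣ f m - 1) :
    d ∣ (∏ m ∈ Finset.range b, f m) - ∏ m ∈ Finset.range a, f m := by
  rw [← Finset.prod_range_mul_prod_Ico f hab]
  have := dvd_prod_sub_one (d := d) (Finset.Ico a b) f
    fun m hm => h m (Finset.mem_Ico.mp hm).1
  have h2 := this.mul_left (∏ m ∈ Finset.range a, f m)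
  rwa [mul_sub, mul_one] at h2

theorem eq_of_forall_X_pow_dvd {a b : PowerSeries ℂ}
    (h : ∀ N : ℕ, (PowerSeries.X : PowerSeries ℂ) ^ N ∣ a - b) : a = b := by
  ext n
  have := PowerSeries.X_pow_dvd_iff.mp (h (n + 1)) n (Nat.lt_succ_self n)
  rwa [map_sub, sub_eq_zero] at this

theorem mul_inv_cancel_of_one {a : PowerSeries ℂ} (h : PowerSeries.constantCoeff a = 1) :
    a * a⁻¹ = 1 := PowerSeries.mul_inv_cancel _ (by simp [h])

theorem dvd_of_dvd_mul_of_one {d a b : PowerSeries ℂ} (h : PowerSeries.constantCoeff a = 1)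
    (hd : d ∣ a * b) : d ∣ b := by
  have := hd.mul_left a⁻¹
  rwa [← mul_assoc, mul_comm a⁻¹, mul_inv_cancel_of_one h, one_mul] at this

/-- The coefficientwise limit of a sequence of power series whose `n`-th coefficient is constant
from the index `n + 1` on. -/
noncomputable def coeffLimit (u : ℕ → PowerSeries ℂ) : PowerSeries ℂ :=
  PowerSeries.mk fun n => PowerSeries.coeff n (u (n + 1))

theorem dvd_sub_of_dvd_succ_sub {u : ℕ → PowerSeries ℂ}
    (h : ∀ n, (PowerSeries.X : PowerSeries ℂ) ^ n ∣ u (n + 1) - u n) {N M : ℕ} (hNM : N ≤ M) :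
    (PowerSeries.X : PowerSeries ℂ) ^ N ∣ u M - u N := by
  induction M, hNM using Nat.le_induction with
  | base => simp
  | succ M hM ih => exact dvd_sub_trans ((pow_dvd_pow _ hM).trans (h M)) ih

theorem dvd_coeffLimit_sub {u : ℕ → PowerSeries ℂ}
    (h : ∀ n, (PowerSeries.X : PowerSeries ℂ) ^ n ∣ u (n + 1) - u n) {N M : ℕ} (hNM : N ≤ M) :
    (PowerSeries.X : PowerSeries ℂ) ^ N ∣ coeffLimit u - u M := by
  rw [PowerSeries.X_pow_dvd_iff]
  intro m hm
  have := PowerSeries.X_pow_dvd_iff.mp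
    (dvd_sub_of_dvd_succ_sub h (show m + 1 ≤ M by omega)) m (Nat.lt_succ_self m)
  rw [map_sub, sub_eq_zero] at this ⊢
  rw [coeffLimit, PowerSeries.coeff_mk, this]

/-- The sum of the series `∑ f n`, meaningful if `X ^ n ∣ f n`. -/
noncomputable def seriesSum (f : ℕ → PowerSeries ℂ) : PowerSeries ℂ :=
  coeffLimit fun N => ∑ n ∈ Finset.range N, f n

theorem dvd_seriesSum_sub {f : ℕ → PowerSeries ℂ}
    (h : ∀ n, (PowerSeries.X : PowerSeries ℂ) ^ n ∣ f n) {N M : ℕ} (hNM : N ≤ M) :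
    (PowerSeries.X : PowerSeries ℂ) ^ N ∣ seriesSum f - ∑ n ∈ Finset.range M, f n :=
  dvd_coeffLimit_sub (u := fun N => ∑ n ∈ Finset.range N, f n)
    (fun n => by simpa [Finset.sum_range_succ] using h n) hNM

/-! ### The product side modulo powers of `X` -/

theorem X_pow_dvd_prodFactor_sub_one (k i m : ℕ) :
    (PowerSeries.X : PowerSeries ℂ) ^ (m + 1) ∣ prodFactor k i m - 1 := by
  unfold prodFactor
  split_ifs
  · refine ⟨(1 - (PowerSeries.X : PowerSeries ℂ) ^ (m + 1))⁻¹, ?_⟩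
    have := mul_inv_cancel_of_one (a := 1 - (PowerSeries.X : PowerSeries ℂ) ^ (m + 1)) (by simp)
    linear_combination this
  · simp

open scoped PowerSeries.WithPiTopology in
-- The bridge from the topological infinite product to congruences: each coefficient of the partial
-- products is eventually constant, so uniqueness of limits identifies it with the coefficient of
-- `prodSide`.
theorem X_pow_dvd_prodSide_sub (k i : ℕ) {N M : ℕ} (hNM : N ≤ M) :
    (PowerSeries.X : PowerSeries ℂ) ^ N ∣
      prodSide k i - ∏ m ∈ Finset.range M, prodFactor k i m := by
  rw [PowerSeries.X_pow_dvd_iff]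
  intro n hn
  rw [map_sub, sub_eq_zero]
  have h1 := (multipliable_prodFactor k i).hasProd.tendsto_prod_nat
  have h2 := ((PowerSeries.WithPiTopology.continuous_coeff ℂ n).tendsto _).comp h1
  refine tendsto_nhds_unique h2 (tendsto_const_nhds.congr' ?_)
  filter_upwards [Filter.eventually_ge_atTop M] with K hK
  have h3 := dvd_prod_range_sub (d := (PowerSeries.X : PowerSeries ℂ) ^ N) (prodFactor k i) hK
    fun m hm => (pow_dvd_pow _ (by omega)).trans (X_pow_dvd_prodFactor_sub_one k i m)
  have h4 := PowerSeries.X_pow_dvd_iff.mp h3 n hn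
  rw [map_sub, sub_eq_zero] at h4
  exact h4.symm

/-! ### Gaussian binomial coefficients and the Jacobi triple product -/

section GaussBinom

variable {R : Type*} [CommRing R]

/-- The Gaussian binomial coefficients, by the `q`-Pascal rule. -/
def gaussBinom (Q : R) : ℕ → ℕ → R
  | _, 0 => 1
  | 0, _ + 1 => 0
  | n + 1, r + 1 => gaussBinom Q n r + Q ^ (r + 1) * gaussBinom Q n (r + 1)

/-- `(Q; Q)_n = (1 - Q) ⋯ (1 - Q ^ n)`. -/
def qFact (Q : R) (n : ℕ) : R := ∏ t ∈ Finset.range n, (1 - Q ^ (t + 1))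

theorem qFact_succ (Q : R) (n : ℕ) : qFact Q (n + 1) = qFact Q n * (1 - Q ^ (n + 1)) :=
  Finset.prod_range_succ _ _

theorem gaussBinom_zero_right (Q : R) (n : ℕ) : gaussBinom Q n 0 = 1 := by
  cases n <;> rfl

theorem gaussBinom_succ_succ (Q : R) (n r : ℕ) :
    gaussBinom Q (n + 1) (r + 1) = gaussBinom Q n r + Q ^ (r + 1) * gaussBinom Q n (r + 1) := rfl

theorem gaussBinom_eq_zero_of_lt (Q : R) {n r : ℕ} (h : n < r) : gaussBinom Q n r = 0 := by
  induction n generalizing r with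
  | zero =>
    obtain ⟨r, rfl⟩ := Nat.exists_eq_succ_of_ne_zero (by omega : r ≠ 0)
    rfl
  | succ n ih =>
    obtain ⟨r, rfl⟩ := Nat.exists_eq_succ_of_ne_zero (by omega : r ≠ 0)
    rw [Nat.succ_eq_add_one, gaussBinom_succ_succ, ih (by omega), ih (by omega)]
    simp

theorem gaussBinom_self (Q : R) (n : ℕ) : gaussBinom Q n n = 1 := by
  induction n with
  | zero => rfl
  | succ n ih => rw [gaussBinom_succ_succ, ih, gaussBinom_eq_zero_of_lt Q n.lt_succ_self]; simp

/-- Division-free form of the quotient formula. The double induction combines the two Pascal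
summands through (1 - Q^(r+1)) + Q^(r+1) (1 - Q^(n+1)) = 1 - Q^(n+r+2). -/
theorem gaussBinom_mul_qFact (Q : R) (n r : ℕ) :
    gaussBinom Q (n + r) r * (qFact Q r * qFact Q n) = qFact Q (n + r) := by
  induction r generalizing n with
  | zero => simp [gaussBinom_zero_right, qFact]
  | succ r ihr =>
    induction n with
    | zero => simp [gaussBinom_self, qFact]
    | succ n ihn =>
      have h1 := ihr (n + 1)
      rw [show n + 1 + (r + 1) = (n + (r + 1)) + 1 by omega, gaussBinom_succ_succ,
        qFact_succ Q (n + (r + 1)), ← ihn]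
      rw [show n + 1 + r = n + (r + 1) by omega, ← ihn, qFact_succ, qFact_succ Q r] at h1
      rw [qFact_succ Q r, qFact_succ Q n] at *
      linear_combination (1 - Q ^ (r + 1)) * h1

/-- The finite `q`-binomial theorem, in homogeneous form. -/
theorem prod_add_mul_pow (Q x y : R) (n : ℕ) :
    ∏ m ∈ Finset.range n, (x + y * Q ^ m) =
      ∑ r ∈ Finset.range (n + 1),
        gaussBinom Q n r * Q ^ (r.choose 2) * y ^ r * x ^ (n - r) := by
  induction n generalizing y with
  | zero => simp [gaussBinom_zero_right]
  | succ n ih =>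
    -- Splitting off the factor m = 0 leaves the same product with y replaced by yQ, hence the
    -- induction for all y.
    have e1 : ∏ m ∈ Finset.range n, (x + y * Q ^ (m + 1)) =
        ∏ m ∈ Finset.range n, (x + (y * Q) * Q ^ m) :=
      Finset.prod_congr rfl fun m _ => by ring
    rw [Finset.prod_range_succ', e1, ih, pow_zero, mul_one, mul_add,
      Finset.sum_range_succ' _ (n + 1), Finset.sum_mul, Finset.sum_mul]
    have e2 : ∀ r ∈ Finset.range (n + 1),
        gaussBinom Q (n + 1) (r + 1) * Q ^ ((r + 1).choose 2) * y ^ (r + 1) * x ^ (n + 1 - (r + 1)) =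
          gaussBinom Q n r * Q ^ (r.choose 2) * (y * Q) ^ r * x ^ (n - r) * y +
          gaussBinom Q n (r + 1) * Q ^ ((r + 1).choose 2) * (y * Q) ^ (r + 1) * x ^ (n - r) := by
      intro r _
      rw [gaussBinom_succ_succ, Nat.succ_sub_succ, Nat.choose_succ_succ' r 1, Nat.choose_one_right]
      ring
    rw [Finset.sum_congr rfl e2, Finset.sum_add_distrib]
    have e3 : ∑ r ∈ Finset.range (n + 1),
          gaussBinom Q n r * Q ^ (r.choose 2) * (y * Q) ^ r * x ^ (n - r) * x =
        ∑ r ∈ Finset.range (n + 1), gaussBinom Q n (r + 1) * Q ^ ((r + 1).choose 2) *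
          (y * Q) ^ (r + 1) * x ^ (n - r) + x ^ (n + 1) := by
      rw [Finset.sum_range_succ', Finset.sum_range_succ, gaussBinom_eq_zero_of_lt Q n.lt_succ_self]
      simp only [gaussBinom_zero_right, Nat.choose_zero_succ, pow_zero, mul_one, one_mul,
        Nat.sub_zero, zero_mul, add_zero]
      rw [pow_succ]
      congr 1
      refine Finset.sum_congr rfl fun r hr => ?_
      rw [mul_assoc, ← pow_succ, show n - (r + 1) + 1 = n - r by
        have := Finset.mem_range.mp hr; omega]
    rw [e3, gaussBinom_zero_right]
    simp only [Nat.choose_zero_succ, pow_zero, mul_one, one_mul, Nat.sub_zero]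
    ring

end GaussBinom

theorem constantCoeff_qFact_X_pow (s n : ℕ) (hs : 1 ≤ s) :
    PowerSeries.constantCoeff (qFact ((PowerSeries.X : PowerSeries ℂ) ^ s) n) = 1 := by
  rw [qFact, map_prod]
  refine Finset.prod_eq_one fun t _ => ?_
  rw [map_sub, map_pow, map_pow, PowerSeries.constantCoeff_X, zero_pow (by omega),
    zero_pow (by omega)]
  simp

theorem qFact_X_pow_ne_zero (s n : ℕ) (hs : 1 ≤ s) :
    qFact ((PowerSeries.X : PowerSeries ℂ) ^ s) n ≠ 0 := by
  intro h
  have := constantCoeff_qFact_X_pow s n hs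
  rw [h, map_zero] at this
  exact zero_ne_one this

theorem gaussBinom_X_pow_symm (s n r : ℕ) (hs : 1 ≤ s) :
    gaussBinom ((PowerSeries.X : PowerSeries ℂ) ^ s) (n + r) r =
      gaussBinom ((PowerSeries.X : PowerSeries ℂ) ^ s) (n + r) n := by
  have h1 := gaussBinom_mul_qFact ((PowerSeries.X : PowerSeries ℂ) ^ s) n r
  have h2 := gaussBinom_mul_qFact ((PowerSeries.X : PowerSeries ℂ) ^ s) r n
  rw [add_comm r n, ← h1, mul_comm (qFact _ n)] at h2
  exact (mul_right_cancel₀ (mul_ne_zero (qFact_X_pow_ne_zero s r hs)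
    (qFact_X_pow_ne_zero s n hs)) h2).symm

theorem choose_two_add (m n : ℕ) : (m + n).choose 2 = m.choose 2 + n.choose 2 + m * n := by
  induction n with
  | zero => simp
  | succ n ih =>
    rw [← add_assoc, Nat.choose_succ_succ' (m + n) 1, Nat.choose_succ_succ' n 1, ih]
    simp only [Nat.choose_one_right]
    ring

theorem two_mul_choose_two_succ (n : ℕ) : 2 * (n + 1).choose 2 = n * (n + 1) := by
  induction n with
  | zero => simp
  | succ n ih =>
    rw [Nat.choose_succ_succ' (n + 1) 1, Nat.choose_one_right, mul_add, ih]
    ring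

theorem prod_range_neg_pow {R : Type*} [CommRing R] (Q : R) (n : ℕ) :
    ∏ m ∈ Finset.range n, (-Q ^ m) = (-1) ^ n * Q ^ (n.choose 2) := by
  induction n with
  | zero => simp
  | succ n ih =>
    rw [Finset.prod_range_succ, ih, Nat.choose_succ_succ' n 1, Nat.choose_one_right]
    ring

/-- The finite form of the Jacobi triple product, folded to a sum over `n ≥ 0`. -/
theorem finite_tripleProduct (a b M : ℕ) (hs : 1 ≤ a + b) :
    (∏ m ∈ Finset.range (M + 1), (1 - (PowerSeries.X : PowerSeries ℂ) ^ ((a + b) * m + a))) *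
      ∏ m ∈ Finset.range M, (1 - (PowerSeries.X : PowerSeries ℂ) ^ ((a + b) * m + b)) =
    ∑ n ∈ Finset.range (M + 1),
      gaussBinom ((PowerSeries.X : PowerSeries ℂ) ^ (a + b)) (2 * M + 1) (M - n) * (-1) ^ n *
        (PowerSeries.X ^ ((a + b) * n.choose 2 + b * n) -
          PowerSeries.X ^ ((a + b) * (n + 1).choose 2 + a * (n + 1))) := by
  set q : PowerSeries ℂ := PowerSeries.X with hq
  -- With x = q^((a+b)M+a) and y = -1, the first M + 1 of the 2M + 1 factors give, up to sign and a
  -- power of q, the factors with offset a in reversed order; the last M give those with offset b.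
  -- The monomial `c` below collects what is pulled out.
  have h := prod_add_mul_pow (q ^ (a + b)) (q ^ ((a + b) * M + a)) (-1) (M + 1 + M)
  set c : PowerSeries ℂ := (-1) ^ (M + 1) *
    q ^ ((a + b) * (M + 1).choose 2 + ((a + b) * M + a) * M) with hc
  have hc0 : c ≠ 0 :=
    mul_ne_zero (pow_ne_zero _ (neg_ne_zero.mpr one_ne_zero)) (pow_ne_zero _ PowerSeries.X_ne_zero)
  have l1 : ∏ m ∈ Finset.range (M + 1), (q ^ ((a + b) * M + a) + -1 * (q ^ (a + b)) ^ m) =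
      ((-1) ^ (M + 1) * (q ^ (a + b)) ^ ((M + 1).choose 2)) *
        ∏ m ∈ Finset.range (M + 1), (1 - q ^ ((a + b) * m + a)) := by
    rw [← prod_range_neg_pow,
      ← Finset.prod_range_reflect (fun m => 1 - q ^ ((a + b) * m + a)), ← Finset.prod_mul_distrib]
    refine Finset.prod_congr rfl fun m hm => ?_
    obtain ⟨d, rfl⟩ : ∃ d, M = m + d := ⟨M - m, by have := Finset.mem_range.mp hm; omega⟩
    rw [show m + d + 1 - 1 - m = d by omega]
    ring
  have l2 : ∏ m ∈ Finset.range M, (q ^ ((a + b) * M + a) + -1 * (q ^ (a + b)) ^ (M + 1 + m)) =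
      q ^ (((a + b) * M + a) * M) * ∏ m ∈ Finset.range M, (1 - q ^ ((a + b) * m + b)) := by
    have e : q ^ (((a + b) * M + a) * M) =
        ∏ _m ∈ Finset.range M, q ^ ((a + b) * M + a) := by simp [pow_mul]
    rw [e, ← Finset.prod_mul_distrib]
    refine Finset.prod_congr rfl fun m _ => ?_
    ring
  -- The 2M + 2 summands are folded about the middle: r = M - n is paired with r = M + 1 + n, whose
  -- Gaussian binomials agree by symmetry.
  rw [Finset.prod_range_add, l1, l2, show M + 1 + M + 1 = (M + 1) + (M + 1) by omega,
    Finset.sum_range_add, ← Finset.sum_range_reflect, ← Finset.sum_add_distrib] at h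
  apply mul_left_cancel₀ hc0
  refine Eq.trans (by rw [hc]; ring) (h.trans ?_)
  rw [Finset.mul_sum]
  refine Finset.sum_congr rfl fun n hn => ?_
  obtain ⟨d, rfl⟩ : ∃ d, M = n + d := ⟨M - n, by have := Finset.mem_range.mp hn; omega⟩
  have s1 := gaussBinom_X_pow_symm (a + b) d (n + d + 1 + n) hs
  rw [← hq] at s1
  have c1 := choose_two_add (n + d + 1) n
  have c2 := choose_two_add d (n + 1)
  have c3 := two_mul_choose_two_succ n
  rw [show n + d + 1 - 1 - n = d by omega, show n + d - n = d by omega,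
    show n + d + 1 + (n + d) - d = n + d + (n + 1) by omega,
    show n + d + 1 + (n + d) - (n + d + 1 + n) = d by omega,
    show n + d + 1 + (n + d) = d + (n + d + 1 + n) by omega, ← s1,
    show 2 * (n + d) + 1 = d + (n + d + 1 + n) by omega, ← s1, hc, c1,
    show n + d + 1 = d + (n + 1) by omega, c2]
  generalize gaussBinom (q ^ (a + b)) (d + (d + (n + 1) + n)) (d + (n + 1) + n) = g
  have p1 : (-1 : PowerSeries ℂ) ^ (d + (n + 1)) * (-1) ^ n = -(-1) ^ d := by
    rw [← pow_add, show d + (n + 1) + n = d + 1 + 2 * n by omega, pow_add _ _ (2 * n), pow_mul]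
    simp [pow_succ]
  have p2 : (-1 : PowerSeries ℂ) ^ (d + (n + 1) + n) = -(-1) ^ d := by rw [pow_add, p1]
  have x1 : q ^ ((a + b) * (d.choose 2 + (n + 1).choose 2 + d * (n + 1)) +
        ((a + b) * (n + d) + a) * (n + d)) * q ^ ((a + b) * (n + 1).choose 2 + a * (n + 1)) =
      (q ^ (a + b)) ^ d.choose 2 * (q ^ ((a + b) * (n + d) + a)) ^ (n + d + (n + 1)) := by
    rw [← pow_mul, ← pow_mul, ← pow_add, ← pow_add]
    congr 1
    linear_combination (a + b) * c3
  have x2 : q ^ ((a + b) * (d.choose 2 + (n + 1).choose 2 + d * (n + 1)) +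
        ((a + b) * (n + d) + a) * (n + d)) * q ^ ((a + b) * n.choose 2 + b * n) =
      (q ^ (a + b)) ^ (d.choose 2 + (n + 1).choose 2 + d * (n + 1) + n.choose 2 +
        (d + (n + 1)) * n) * (q ^ ((a + b) * (n + d) + a)) ^ d := by
    rw [← pow_mul, ← pow_mul, ← pow_add, ← pow_add]
    congr 1
    ring
  rw [p2]
  generalize q ^ ((a + b) * (d.choose 2 + (n + 1).choose 2 + d * (n + 1)) +
    ((a + b) * (n + d) + a) * (n + d)) = u at *
  generalize q ^ ((a + b) * (n + 1).choose 2 + a * (n + 1)) = u1 at *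
  generalize q ^ ((a + b) * n.choose 2 + b * n) = u2 at *
  generalize (q ^ (a + b)) ^ d.choose 2 = u3 at *
  generalize (q ^ (a + b)) ^ (d.choose 2 + (n + 1).choose 2 + d * (n + 1) + n.choose 2 +
    (d + (n + 1)) * n) = u4 at *
  generalize (q ^ ((a + b) * (n + d) + a)) ^ (n + d + (n + 1)) = u5 at *
  generalize (q ^ ((a + b) * (n + d) + a)) ^ d = u6 at *
  generalize (-1 : PowerSeries ℂ) ^ (d + (n + 1)) = e1 at *
  generalize (-1 : PowerSeries ℂ) ^ n = e2 at *
  generalize (-1 : PowerSeries ℂ) ^ d = e3 at *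
  linear_combination (-g * u * (u2 - u1)) * p1 - g * e3 * x1 + g * e3 * x2

/-- All (Q; Q)_m with m ≥ d agree modulo Q^d. Clearing the denominators of the Gaussian binomial by
a series with constant term 1 leaves two products of such factors. -/
theorem X_pow_dvd_qFact_mul_gaussBinom_sub_one (s n d : ℕ) (hs : 1 ≤ s) :
    ((PowerSeries.X : PowerSeries ℂ) ^ s) ^ d ∣
      qFact ((PowerSeries.X : PowerSeries ℂ) ^ s) (n + d) *
        gaussBinom ((PowerSeries.X : PowerSeries ℂ) ^ s) (2 * (n + d) + 1) d - 1 := by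
  set Q : PowerSeries ℂ := PowerSeries.X ^ s with hQ
  have key : ∀ N, d ≤ N → Q ^ d ∣ qFact Q N - qFact Q d := fun N hN =>
    dvd_prod_range_sub _ hN fun m hm => by
      rw [sub_sub_cancel_left, dvd_neg]
      exact pow_dvd_pow _ (by omega)
  have h := gaussBinom_mul_qFact Q (n + d + 1 + n) d
  rw [show n + d + 1 + n + d = 2 * (n + d) + 1 by ring] at h
  have h1 := dvd_mul_sub_mul (key (n + d) (by omega)) (key (2 * (n + d) + 1) (by omega))
  have h2 := dvd_mul_sub_mul (key d le_rfl) (key (n + d + 1 + n) (by omega))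
  have h3 := dvd_sub_trans h1 (dvd_sub_symm h2)
  apply dvd_of_dvd_mul_of_one (a := qFact Q d * qFact Q (n + d + 1 + n))
    (by rw [map_mul, constantCoeff_qFact_X_pow _ _ hs, constantCoeff_qFact_X_pow _ _ hs, one_mul])
  rw [← h] at h3
  refine h3.trans (dvd_of_eq ?_)
  ring

/-- The `n`-th term of the theta series of the Jacobi triple product, folded to `n ≥ 0`. -/
noncomputable def thetaTerm (a b n : ℕ) : PowerSeries ℂ :=
  (-1) ^ n * (PowerSeries.X ^ ((a + b) * n.choose 2 + b * n) -
    PowerSeries.X ^ ((a + b) * (n + 1).choose 2 + a * (n + 1)))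

theorem X_pow_dvd_thetaTerm (a b n : ℕ) (ha : 1 ≤ a) (hb : 1 ≤ b) :
    (PowerSeries.X : PowerSeries ℂ) ^ n ∣ thetaTerm a b n := by
  refine Dvd.dvd.mul_left (dvd_sub (pow_dvd_pow _ ?_) (pow_dvd_pow _ ?_)) _ <;> nlinarith

/-- The Jacobi triple product, modulo powers of `X`. -/
theorem X_pow_dvd_tripleProduct_sub (a b M : ℕ) (ha : 1 ≤ a) (hb : 1 ≤ b) :
    (PowerSeries.X : PowerSeries ℂ) ^ M ∣
      qFact ((PowerSeries.X : PowerSeries ℂ) ^ (a + b)) M *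
        ((∏ m ∈ Finset.range M, (1 - (PowerSeries.X : PowerSeries ℂ) ^ ((a + b) * m + a))) *
          ∏ m ∈ Finset.range M, (1 - (PowerSeries.X : PowerSeries ℂ) ^ ((a + b) * m + b))) -
      ∑ n ∈ Finset.range M, thetaTerm a b n := by
  have h1 : (PowerSeries.X : PowerSeries ℂ) ^ M ∣
      (∏ m ∈ Finset.range M, (1 - (PowerSeries.X : PowerSeries ℂ) ^ ((a + b) * m + a))) -
      ∏ m ∈ Finset.range (M + 1), (1 - (PowerSeries.X : PowerSeries ℂ) ^ ((a + b) * m + a)) := by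
    refine dvd_sub_symm (dvd_prod_range_sub _ M.le_succ fun m hm => ?_)
    rw [sub_sub_cancel_left, dvd_neg]
    exact pow_dvd_pow _ (by nlinarith)
  have h2 := (h1.mul_right (∏ m ∈ Finset.range M,
    (1 - (PowerSeries.X : PowerSeries ℂ) ^ ((a + b) * m + b)))).mul_left
    (qFact ((PowerSeries.X : PowerSeries ℂ) ^ (a + b)) M)
  rw [sub_mul, mul_sub, finite_tripleProduct a b M (by omega)] at h2
  refine dvd_sub_trans h2 ?_
  have h3 : (PowerSeries.X : PowerSeries ℂ) ^ M ∣
      ∑ n ∈ Finset.range (M + 1), thetaTerm a b n - ∑ n ∈ Finset.range M, thetaTerm a b n := by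
    rw [Finset.sum_range_succ, add_sub_cancel_left]
    exact X_pow_dvd_thetaTerm a b M ha hb
  refine dvd_sub_trans ?_ h3
  rw [Finset.mul_sum, ← Finset.sum_sub_distrib]
  refine Finset.dvd_sum fun n hn => ?_
  obtain ⟨d, rfl⟩ : ∃ d, M = n + d := ⟨M - n, by have := Finset.mem_range.mp hn; omega⟩
  -- The binomial is controlled only modulo Q^(M - n); the factor X^n of the theta term makes up for
  -- the loss.
  have h4 := mul_dvd_mul (X_pow_dvd_thetaTerm a b n ha hb)
    (X_pow_dvd_qFact_mul_gaussBinom_sub_one (a + b) n d (by omega))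
  rw [← pow_mul, ← pow_add] at h4
  refine (pow_dvd_pow _ (by nlinarith)).trans (h4.trans (dvd_of_eq ?_))
  rw [show n + d - n = d by omega, thetaTerm]
  ring

/-! ### The zeroth shelf as a theta series -/

/-- A factor of `∏ (1 + q ^ (2t + 1)) / (1 - q ^ (2t + 2))`. -/
noncomputable def commonFactor (t : ℕ) : PowerSeries ℂ :=
  (1 + PowerSeries.X ^ (2 * t + 1)) * (1 - PowerSeries.X ^ (2 * t + 2))⁻¹

/-- The infinite product `∏ (1 + q ^ (2t + 1)) / (1 - q ^ (2t + 2))`, which is the product of the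
`(1 - q ^ m)⁻¹` over the `m ≥ 1` with `m ≢ 2 (mod 4)`. -/
noncomputable def commonProd : PowerSeries ℂ :=
  coeffLimit fun N => ∏ t ∈ Finset.range N, commonFactor t

theorem one_sub_X_pow_mul_inv (n : ℕ) :
    (1 - (PowerSeries.X : PowerSeries ℂ) ^ (n + 1)) *
      (1 - (PowerSeries.X : PowerSeries ℂ) ^ (n + 1))⁻¹ = 1 :=
  mul_inv_cancel_of_one (by simp)

theorem one_add_X_pow_mul_inv (n : ℕ) :
    (1 + (PowerSeries.X : PowerSeries ℂ) ^ (n + 1)) *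
      (1 + (PowerSeries.X : PowerSeries ℂ) ^ (n + 1))⁻¹ = 1 :=
  mul_inv_cancel_of_one (by simp)

theorem X_pow_dvd_commonFactor_sub_one (t : ℕ) :
    (PowerSeries.X : PowerSeries ℂ) ^ t ∣ commonFactor t - 1 := by
  refine ⟨(PowerSeries.X ^ (t + 1) + PowerSeries.X ^ (t + 2)) *
    (1 - PowerSeries.X ^ (2 * t + 2))⁻¹, ?_⟩
  have h := one_sub_X_pow_mul_inv (2 * t + 1)
  unfold commonFactor
  linear_combination h

theorem X_pow_dvd_commonProd_sub {N M : ℕ} (h : N ≤ M) :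
    (PowerSeries.X : PowerSeries ℂ) ^ N ∣ commonProd - ∏ t ∈ Finset.range M, commonFactor t :=
  dvd_coeffLimit_sub (u := fun N => ∏ t ∈ Finset.range N, commonFactor t)
    (fun n => dvd_prod_range_sub _ n.le_succ fun m hm =>
      (pow_dvd_pow _ hm).trans (X_pow_dvd_commonFactor_sub_one m)) h

/-- `1 - q ^ (m + 1)`, or `1` if `m + 1 ≡ 2 (mod 4)`. -/
noncomputable def factorNeTwoModFour (m : ℕ) : PowerSeries ℂ :=
  if (m + 1) % 4 = 2 then 1 else 1 - PowerSeries.X ^ (m + 1)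

theorem prod_factorNeTwoModFour (L : ℕ) :
    ∏ m ∈ Finset.range (4 * L), factorNeTwoModFour m =
      (∏ t ∈ Finset.range (2 * L), (1 - (PowerSeries.X : PowerSeries ℂ) ^ (2 * t + 1))) *
        ∏ t ∈ Finset.range L, (1 - (PowerSeries.X : PowerSeries ℂ) ^ (4 * t + 4)) := by
  induction L with
  | zero => simp
  | succ L ih =>
    rw [show 4 * (L + 1) = 4 * L + 1 + 1 + 1 + 1 by ring, show 2 * (L + 1) = 2 * L + 1 + 1 by ring]
    simp only [Finset.prod_range_succ]
    rw [ih]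
    unfold factorNeTwoModFour
    rw [if_neg (by omega), if_pos (by omega), if_neg (by omega), if_neg (by omega),
      show 2 * (2 * L) + 1 = 4 * L + 1 by ring, show 2 * (2 * L + 1) + 1 = 4 * L + 1 + 1 + 1 by ring]
    ring

theorem prod_one_sub_X_pow_even (L : ℕ) :
    ∏ t ∈ Finset.range (2 * L), (1 - (PowerSeries.X : PowerSeries ℂ) ^ (2 * t + 2)) =
      (∏ t ∈ Finset.range L, (1 - (PowerSeries.X : PowerSeries ℂ) ^ (4 * t + 2))) *
        ∏ t ∈ Finset.range L, (1 - (PowerSeries.X : PowerSeries ℂ) ^ (4 * t + 4)) := by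
  induction L with
  | zero => simp
  | succ L ih =>
    rw [show 2 * (L + 1) = 2 * L + 1 + 1 by ring]
    simp only [Finset.prod_range_succ]
    rw [ih, show 2 * (2 * L) + 2 = 4 * L + 2 by ring, show 2 * (2 * L + 1) + 2 = 4 * L + 4 by ring]
    ring

/-- Since (1 + q^(2t+1)) (1 - q^(2t+1)) = 1 - q^(4t+2), the product cancels against the even
factors, split modulo 4. Only factors with L ≤ t < 2L survive, and these are 1 modulo X^L. -/
theorem X_pow_dvd_commonFactor_mul_sub_one (L : ℕ) :
    (PowerSeries.X : PowerSeries ℂ) ^ L ∣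
      (∏ t ∈ Finset.range (2 * L), commonFactor t) *
        (∏ m ∈ Finset.range (4 * L), factorNeTwoModFour m) - 1 := by
  have h1 : (∏ t ∈ Finset.range (2 * L), (1 - (PowerSeries.X : PowerSeries ℂ) ^ (2 * t + 2))) *
      (∏ t ∈ Finset.range (2 * L), commonFactor t) *
      (∏ t ∈ Finset.range (2 * L), (1 - (PowerSeries.X : PowerSeries ℂ) ^ (2 * t + 1))) =
      ∏ t ∈ Finset.range (2 * L), (1 - (PowerSeries.X : PowerSeries ℂ) ^ (4 * t + 2)) := by
    rw [← Finset.prod_mul_distrib, ← Finset.prod_mul_distrib]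
    refine Finset.prod_congr rfl fun t _ => ?_
    have h := one_sub_X_pow_mul_inv (2 * t + 1)
    unfold commonFactor
    linear_combination (1 - (PowerSeries.X : PowerSeries ℂ) ^ (4 * t + 2)) * h
  have h2 : (PowerSeries.X : PowerSeries ℂ) ^ L ∣
      (∏ t ∈ Finset.range (2 * L), (1 - (PowerSeries.X : PowerSeries ℂ) ^ (4 * t + 2))) -
        ∏ t ∈ Finset.range L, (1 - (PowerSeries.X : PowerSeries ℂ) ^ (4 * t + 2)) :=
    dvd_prod_range_sub _ (by omega) fun m hm => by
      rw [sub_sub_cancel_left, dvd_neg]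
      exact pow_dvd_pow _ (by omega)
  apply dvd_of_dvd_mul_of_one
    (a := ∏ t ∈ Finset.range (2 * L), (1 - (PowerSeries.X : PowerSeries ℂ) ^ (2 * t + 2)))
  · rw [map_prod]
    exact Finset.prod_eq_one fun t _ => by simp
  · refine (h2.mul_right (∏ t ∈ Finset.range L,
      (1 - (PowerSeries.X : PowerSeries ℂ) ^ (4 * t + 4)))).trans (dvd_of_eq ?_)
    rw [mul_sub, mul_one, prod_factorNeTwoModFour, sub_mul, ← h1, ← prod_one_sub_X_pow_even]
    ring

/-- With k = i + p + 1 and position i + 1, the residues 2k ± (2i + 1) become 4i + 2p + 3 and 2p + 1,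
free of subtraction and already reduced modulo 4k. -/
theorem allowedPart_iff (i p m : ℕ) :
    AllowedPart (i + p + 1) (i + 1) m ↔ m % 4 ≠ 2 ∧ m % (4 * (i + p + 1)) ≠ 0 ∧
      m % (4 * (i + p + 1)) ≠ 4 * i + 2 * p + 3 ∧ m % (4 * (i + p + 1)) ≠ 2 * p + 1 := by
  have e1 : (2 * ((i + p + 1 : ℕ) : ℤ) + (2 * ((i + 1 : ℕ) : ℤ) - 1)) =
      ((4 * i + 2 * p + 3 : ℕ) : ℤ) := by push_cast; ring
  have e2 : (2 * ((i + p + 1 : ℕ) : ℤ) - (2 * ((i + 1 : ℕ) : ℤ) - 1)) =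
      ((2 * p + 1 : ℕ) : ℤ) := by push_cast; ring
  have e3 : (4 * ((i + p + 1 : ℕ) : ℤ)) = ((4 * (i + p + 1) : ℕ) : ℤ) := by push_cast; ring
  have e4 : (2 : ℤ) = ((2 : ℕ) : ℤ) := rfl
  have e5 : (4 : ℤ) = ((4 : ℕ) : ℤ) := rfl
  have e6 : (0 : ℤ) = ((0 : ℕ) : ℤ) := rfl
  unfold AllowedPart
  rw [e1, e2, e3, e6, e5, e4, Int.natCast_modEq_iff, Int.natCast_modEq_iff, Int.natCast_modEq_iff,
    Int.natCast_modEq_iff]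
  unfold Nat.ModEq
  rw [Nat.mod_eq_of_lt (show 4 * i + 2 * p + 3 < 4 * (i + p + 1) by omega),
    Nat.mod_eq_of_lt (show 2 * p + 1 < 4 * (i + p + 1) by omega)]
  simp

/-- `1 - q ^ (m + 1)` if `m + 1 ≡ 0, 2k ± (2i + 1) (mod 4k)` where `k = i + p + 1`, and `1`
otherwise. -/
noncomputable def exceptionalFactor (i p m : ℕ) : PowerSeries ℂ :=
  if (m + 1) % (4 * (i + p + 1)) = 0 ∨ (m + 1) % (4 * (i + p + 1)) = 4 * i + 2 * p + 3 ∨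
    (m + 1) % (4 * (i + p + 1)) = 2 * p + 1 then 1 - PowerSeries.X ^ (m + 1) else 1

theorem prodFactor_mul_factorNeTwoModFour (i p m : ℕ) :
    prodFactor (i + p + 1) (i + 1) m * factorNeTwoModFour m = exceptionalFactor i p m := by
  -- The three exceptional residues are 0 or odd modulo 4, so they never meet the class 2 modulo 4.
  have hmod : (m + 1) % (4 * (i + p + 1)) % 4 = (m + 1) % 4 := Nat.mod_mul_right_mod _ _ _
  have hinv := one_sub_X_pow_mul_inv m
  unfold prodFactor factorNeTwoModFour exceptionalFactor
  by_cases h2 : (m + 1) % 4 = 2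
  · rw [if_neg (by rw [allowedPart_iff]; tauto), if_pos h2, if_neg (by omega), one_mul]
  · rw [if_neg h2]
    by_cases h : (m + 1) % (4 * (i + p + 1)) = 0 ∨
      (m + 1) % (4 * (i + p + 1)) = 4 * i + 2 * p + 3 ∨ (m + 1) % (4 * (i + p + 1)) = 2 * p + 1
    · rw [if_neg (by rw [allowedPart_iff]; tauto), if_pos h, one_mul]
    · rw [if_pos (by rw [allowedPart_iff]; tauto), if_neg h, mul_comm, hinv]

theorem prod_exceptionalFactor (i p M : ℕ) :
    ∏ m ∈ Finset.range (4 * (i + p + 1) * M), exceptionalFactor i p m =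
      qFact ((PowerSeries.X : PowerSeries ℂ) ^ ((2 * p + 1) + (4 * i + 2 * p + 3))) M *
        ((∏ m ∈ Finset.range M, (1 - (PowerSeries.X : PowerSeries ℂ) ^
            (((2 * p + 1) + (4 * i + 2 * p + 3)) * m + (2 * p + 1)))) *
          ∏ m ∈ Finset.range M, (1 - (PowerSeries.X : PowerSeries ℂ) ^
            (((2 * p + 1) + (4 * i + 2 * p + 3)) * m + (4 * i + 2 * p + 3)))) := by
  induction M with
  | zero => simp [qFact]
  | succ M ih =>
    -- A full period modulo 4k = a + b, with a = 2p + 1 and b = 4i + 2p + 3, meets each exceptional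
    -- residue once and so adds one factor to each of the three products.
    have h : ∏ r ∈ Finset.range (4 * (i + p + 1)),
        exceptionalFactor i p (4 * (i + p + 1) * M + r) =
        ∏ r ∈ Finset.range (4 * (i + p + 1)),
          ((if r = 4 * i + 4 * p + 3 then 1 - (PowerSeries.X : PowerSeries ℂ) ^
            ((2 * p + 1 + (4 * i + 2 * p + 3)) * (M + 1)) else 1) *
          ((if r = 2 * p then 1 - (PowerSeries.X : PowerSeries ℂ) ^
            (((2 * p + 1) + (4 * i + 2 * p + 3)) * M + (2 * p + 1)) else 1) *
          (if r = 4 * i + 2 * p + 2 then 1 - (PowerSeries.X : PowerSeries ℂ) ^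
            (((2 * p + 1) + (4 * i + 2 * p + 3)) * M + (4 * i + 2 * p + 3)) else 1))) := by
      refine Finset.prod_congr rfl fun r hr => ?_
      have hr := Finset.mem_range.mp hr
      have hm : (4 * (i + p + 1) * M + r + 1) % (4 * (i + p + 1)) =
          (r + 1) % (4 * (i + p + 1)) := by
        rw [add_assoc, Nat.mul_add_mod]
      unfold exceptionalFactor
      rw [hm]
      by_cases h1 : r = 4 * i + 4 * p + 3
      · subst h1
        rw [show 4 * i + 4 * p + 3 + 1 = 4 * (i + p + 1) by ring, Nat.mod_self, if_pos (Or.inl rfl),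
          if_pos rfl, if_neg (by omega), if_neg (by omega), mul_one, mul_one]
        congr 2
        ring
      · rw [Nat.mod_eq_of_lt (show r + 1 < 4 * (i + p + 1) by omega), if_neg h1, one_mul]
        by_cases h2 : r = 2 * p
        · subst h2
          rw [if_pos (by omega), if_pos rfl, if_neg (by omega), mul_one]
          congr 2
          ring
        · rw [if_neg h2, one_mul]
          by_cases h3 : r = 4 * i + 2 * p + 2
          · subst h3
            rw [if_pos (by omega), if_pos rfl]
            congr 2
            ring
          · rw [if_neg h3, if_neg (by omega)]
    rw [mul_add, mul_one, Finset.prod_range_add, ih, h, Finset.prod_mul_distrib,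
      Finset.prod_mul_distrib, Finset.prod_ite_eq', Finset.prod_ite_eq', Finset.prod_ite_eq',
      if_pos (Finset.mem_range.mpr (by omega)), if_pos (Finset.mem_range.mpr (by omega)),
      if_pos (Finset.mem_range.mpr (by omega)), qFact_succ, Finset.prod_range_succ,
      Finset.prod_range_succ, pow_mul _ _ (M + 1)]
    ring

/-- The product side, by the Jacobi triple product. -/
theorem prodSide_eq (i p : ℕ) :
    prodSide (i + p + 1) (i + 1) =
      commonProd * seriesSum (thetaTerm (2 * p + 1) (4 * i + 2 * p + 3)) := by
  apply eq_of_forall_X_pow_dvd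
  intro N
  have hk : N ≤ (i + p + 1) * N := Nat.le_mul_of_pos_left N (by omega)
  set P := ∏ m ∈ Finset.range (4 * (i + p + 1) * N), prodFactor (i + p + 1) (i + 1) m
  set E := ∏ m ∈ Finset.range (4 * (i + p + 1) * N), exceptionalFactor i p m with hE
  set W := ∏ m ∈ Finset.range (4 * (i + p + 1) * N), factorNeTwoModFour m with hW
  set C := ∏ t ∈ Finset.range (2 * ((i + p + 1) * N)), commonFactor t with hC
  have hPW : P * W = E := by
    rw [← Finset.prod_mul_distrib]
    exact Finset.prod_congr rfl fun m _ => prodFactor_mul_factorNeTwoModFour i p m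
  have h1 : (PowerSeries.X : PowerSeries ℂ) ^ N ∣ prodSide (i + p + 1) (i + 1) - P :=
    X_pow_dvd_prodSide_sub _ _ (by nlinarith)
  have h2 : (PowerSeries.X : PowerSeries ℂ) ^ N ∣ C * W - 1 := by
    have := X_pow_dvd_commonFactor_mul_sub_one ((i + p + 1) * N)
    rw [← mul_assoc 4] at this
    exact (pow_dvd_pow _ hk).trans this
  have h3 : (PowerSeries.X : PowerSeries ℂ) ^ N ∣ commonProd - C :=
    X_pow_dvd_commonProd_sub (by omega)
  have h4 : (PowerSeries.X : PowerSeries ℂ) ^ N ∣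
      E - seriesSum (thetaTerm (2 * p + 1) (4 * i + 2 * p + 3)) := by
    rw [hE, prod_exceptionalFactor]
    exact dvd_sub_trans (X_pow_dvd_tripleProduct_sub _ _ N (by omega) (by omega))
      (dvd_sub_symm (dvd_seriesSum_sub
        (fun n => X_pow_dvd_thetaTerm _ _ n (by omega) (by omega)) le_rfl))
  -- What remains is P ≡ P(CW) = C(PW) = CE modulo X^N.
  refine dvd_sub_trans h1 (dvd_sub_trans ?_ (dvd_sub_symm (dvd_mul_sub_mul h3 (dvd_sub_symm h4))))
  rw [← hPW]
  refine ((dvd_sub_symm h2).mul_left P).trans (dvd_of_eq ?_)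
  ring

/-! ### Closed form of the shelves -/

/-- `∏ (1 - q ^ (2t))` over `n < t ≤ n + j`, divided by `∏ (1 + q ^ (2t + 1))` over
`n ≤ t ≤ n + j`. -/
noncomputable def pochRatio (j n : ℕ) : PowerSeries ℂ :=
  (∏ t ∈ Finset.range j, (1 - PowerSeries.X ^ (2 * (n + t) + 2))) *
    ∏ t ∈ Finset.range (j + 1), (1 + PowerSeries.X ^ (2 * (n + t) + 1))⁻¹

/-- This relation and `pochRatio_succ_right` express both neighbours, (j, n) and (j, n + 1), through
(j + 1, n); nothing else about `pochRatio` enters `shelfTerm_sub`. -/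
theorem pochRatio_succ_left (j n : ℕ) :
    pochRatio (j + 1) n * (1 + PowerSeries.X ^ (2 * n + 2 * j + 3)) =
      pochRatio j n * (1 - PowerSeries.X ^ (2 * n + 2 * j + 2)) := by
  have h := one_add_X_pow_mul_inv (2 * (n + (j + 1)))
  unfold pochRatio
  rw [Finset.prod_range_succ _ j, Finset.prod_range_succ _ (j + 1),
    show 2 * n + 2 * j + 3 = 2 * (n + (j + 1)) + 1 by ring,
    show 2 * n + 2 * j + 2 = 2 * (n + j) + 2 by ring]
  generalize (1 + (PowerSeries.X : PowerSeries ℂ) ^ (2 * (n + (j + 1)) + 1))⁻¹ = u at *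
  linear_combination ((∏ t ∈ Finset.range j, (1 - PowerSeries.X ^ (2 * (n + t) + 2))) *
    (1 - PowerSeries.X ^ (2 * (n + j) + 2)) *
    ∏ t ∈ Finset.range (j + 1), (1 + PowerSeries.X ^ (2 * (n + t) + 1))⁻¹) * h

theorem pochRatio_succ_right (j n : ℕ) :
    pochRatio (j + 1) n * (1 + PowerSeries.X ^ (2 * n + 1)) =
      pochRatio j (n + 1) * (1 - PowerSeries.X ^ (2 * n + 2)) := by
  have h := one_add_X_pow_mul_inv (2 * n)
  unfold pochRatio
  rw [Finset.prod_range_succ' _ j, Finset.prod_range_succ' _ (j + 1)]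
  simp only [show ∀ t, n + 1 + t = n + (t + 1) from fun t => by ring, add_zero]
  generalize (1 + (PowerSeries.X : PowerSeries ℂ) ^ (2 * n + 1))⁻¹ = u at *
  linear_combination ((∏ t ∈ Finset.range j, (1 - PowerSeries.X ^ (2 * (n + (t + 1)) + 2))) *
    (1 - PowerSeries.X ^ (2 * n + 2)) *
    ∏ t ∈ Finset.range (j + 1), (1 + PowerSeries.X ^ (2 * (n + (t + 1)) + 1))⁻¹) * h

/-- The terms of the series `shelfSeries`. -/
noncomputable def shelfTerm (i p j n : ℕ) : PowerSeries ℂ :=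
  (-1) ^ n * PowerSeries.X ^ (2 * (i + p) * (n ^ 2 + j * n) + 2 * i * n + n) *
    (1 - PowerSeries.X ^ (2 * p * (2 * n + j + 1))) * pochRatio j n

/-- With `k = i + p`, this is Andrews' series `H_{k,p}(-1/q; q^(2j+2); q²)`, up to the factor
`commonProd`. -/
noncomputable def shelfSeries (i p j : ℕ) : PowerSeries ℂ := seriesSum (shelfTerm i p j)

theorem X_pow_dvd_shelfTerm (i p j n : ℕ) :
    (PowerSeries.X : PowerSeries ℂ) ^ (2 * (i + p) * (n ^ 2 + j * n) + n) ∣ shelfTerm i p j n := by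
  refine Dvd.dvd.mul_right (Dvd.dvd.mul_right (Dvd.dvd.mul_left (pow_dvd_pow _ ?_) _) _) _
  omega

theorem X_pow_dvd_shelfSeries_sub (i p j N : ℕ) :
    (PowerSeries.X : PowerSeries ℂ) ^ N ∣
      shelfSeries i p j - ∑ n ∈ Finset.range N, shelfTerm i p j n :=
  dvd_seriesSum_sub (fun n => (pow_dvd_pow _ (by omega)).trans (X_pow_dvd_shelfTerm i p j n)) le_rfl

theorem shelfSeries_zero (i j : ℕ) : shelfSeries i 0 j = 0 := by
  apply eq_of_forall_X_pow_dvd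
  intro N
  have := X_pow_dvd_shelfSeries_sub i 0 j N
  rwa [Finset.sum_eq_zero fun n _ => by simp [shelfTerm]] at this

/-- Andrews' series `J_{k,p+1}(-1/q; q^(2j); q²)` with `k = i + p + 1`, up to the factor
`commonProd`. -/
noncomputable def shelfCore (i p j : ℕ) : PowerSeries ℂ :=
  shelfSeries i (p + 1) j + PowerSeries.X ^ (2 * j + 1) * shelfSeries (i + 1) p j

/-- The part of `shelfTerm i (p + 1) j n - shelfTerm (i + 1) p j n` that telescopes. -/
noncomputable def boundaryTerm (i p j n : ℕ) : PowerSeries ℂ :=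
  (-1) ^ n * PowerSeries.X ^ (2 * (i + p + 1) * (n ^ 2 + j * n) + 2 * i * n + n) *
    (1 - PowerSeries.X ^ (2 * n)) * pochRatio j n

/-- With N = 2n + j + 1, the bracket 1 - X^(2n) - X^(2(p+1)N) + X^(2pN+2n) of the difference equals
(1 - X^(2n)) + X^(2pN+2n) (1 - X^(2n+2j+2)). The first part is `boundaryTerm i p j n`; the second,
together with the boundary term at n + 1, is rewritten through `pochRatio (j + 1) n` and yields the
two terms of the next shelf. -/
theorem shelfTerm_sub (i p j n : ℕ) :
    shelfTerm i (p + 1) j n - shelfTerm (i + 1) p j n =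
      PowerSeries.X ^ (2 * (j + 1) * p) * (shelfTerm p (i + 1) (j + 1) n +
        PowerSeries.X ^ (2 * (j + 1) + 1) * shelfTerm (p + 1) i (j + 1) n) +
      (boundaryTerm i p j n - boundaryTerm i p j (n + 1)) := by
  have h1 := pochRatio_succ_left j n
  have h2 := pochRatio_succ_right j n
  unfold shelfTerm boundaryTerm
  linear_combination ((-1) ^ (n + 1) * PowerSeries.X ^ (2 * (j + 1) * p + 2 * (p + (i + 1)) *
      (n ^ 2 + (j + 1) * n) + 2 * p * n + n)) * h1 +
    ((-1) ^ n * PowerSeries.X ^ (2 * (j + 1) * p + 2 * (p + (i + 1)) *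
      (n ^ 2 + (j + 1) * n) + 2 * p * n + n + 2 * i * (2 * n + j + 2) + 2 * n + 2 * j + 3)) * h2

/-- The boundary terms telescope: the one at 0 vanishes through its factor 1 - X^(2n), and the one
at N is divisible by X^N. -/
theorem shelfSeries_sub (i p j : ℕ) :
    shelfSeries i (p + 1) j - shelfSeries (i + 1) p j =
      PowerSeries.X ^ (2 * (j + 1) * p) * shelfCore p i (j + 1) := by
  apply eq_of_forall_X_pow_dvd
  intro N
  have h1 := dvd_sub (X_pow_dvd_shelfSeries_sub i (p + 1) j N)
    (X_pow_dvd_shelfSeries_sub (i + 1) p j N)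
  have h2 := (dvd_add (X_pow_dvd_shelfSeries_sub p (i + 1) (j + 1) N)
    ((X_pow_dvd_shelfSeries_sub (p + 1) i (j + 1) N).mul_left
      (PowerSeries.X ^ (2 * (j + 1) + 1)))).mul_left (PowerSeries.X ^ (2 * (j + 1) * p))
  have h3 : (PowerSeries.X : PowerSeries ℂ) ^ N ∣ boundaryTerm i p j N := by
    refine Dvd.dvd.mul_right (Dvd.dvd.mul_right (Dvd.dvd.mul_left (pow_dvd_pow _ ?_) _) _) _
    omega
  have h4 : ∑ n ∈ Finset.range N, shelfTerm i (p + 1) j n -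
      ∑ n ∈ Finset.range N, shelfTerm (i + 1) p j n =
      PowerSeries.X ^ (2 * (j + 1) * p) * (∑ n ∈ Finset.range N, shelfTerm p (i + 1) (j + 1) n +
        PowerSeries.X ^ (2 * (j + 1) + 1) *
          ∑ n ∈ Finset.range N, shelfTerm (p + 1) i (j + 1) n) - boundaryTerm i p j N := by
    rw [← Finset.sum_sub_distrib, Finset.sum_congr rfl fun n _ => shelfTerm_sub i p j n,
      Finset.sum_add_distrib, Finset.sum_range_sub', ← Finset.mul_sum, Finset.sum_add_distrib,
      ← Finset.mul_sum]
    have : boundaryTerm i p j 0 = 0 := by simp [boundaryTerm]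
    rw [this]
    ring
  refine (dvd_sub (dvd_sub h1 h2) h3).trans (dvd_of_eq ?_)
  unfold shelfCore
  linear_combination -h4

/-- At j = 0 the two numerators combine to (1 + X^(2n+1)) (1 - X^(2p(2n+1)+2n+1)), and the first
factor cancels `pochRatio 0 n`. -/
theorem shelfCore_zero (i p : ℕ) :
    shelfCore i p 0 = seriesSum (thetaTerm (2 * p + 1) (4 * i + 2 * p + 3)) := by
  have hterm : ∀ n, shelfTerm i (p + 1) 0 n + PowerSeries.X ^ 1 * shelfTerm (i + 1) p 0 n =
      thetaTerm (2 * p + 1) (4 * i + 2 * p + 3) n := by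
    intro n
    have h := one_add_X_pow_mul_inv (2 * n)
    have c1 := two_mul_choose_two_succ n
    have c2 : (n + 1).choose 2 = n + n.choose 2 := by
      rw [Nat.choose_succ_succ' n 1, Nat.choose_one_right]
    have e1 : (2 * p + 1 + (4 * i + 2 * p + 3)) * n.choose 2 + (4 * i + 2 * p + 3) * n =
        2 * (i + (p + 1)) * (n ^ 2 + 0 * n) + 2 * i * n + n := by
      have : 2 * n.choose 2 + n = n ^ 2 := by nlinarith
      linear_combination 2 * (i + p + 1) * this
    have e2 : (2 * p + 1 + (4 * i + 2 * p + 3)) * (n + 1).choose 2 + (2 * p + 1) * (n + 1) =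
        2 * (i + (p + 1)) * (n ^ 2 + 0 * n) + 2 * i * n + n + (2 * p * (2 * n + 1) + 2 * n + 1) := by
      linear_combination 2 * (i + p + 1) * c1
    unfold thetaTerm shelfTerm pochRatio
    rw [e1, e2]
    simp only [Finset.range_zero, Finset.prod_empty, zero_add, Finset.prod_range_one, add_zero]
    generalize (1 + (PowerSeries.X : PowerSeries ℂ) ^ (2 * n + 1))⁻¹ = u at *
    linear_combination ((-1) ^ n * (PowerSeries.X ^ (2 * (i + (p + 1)) * (n ^ 2 + 0 * n) +
      2 * i * n + n) * (1 - PowerSeries.X ^ (2 * p * (2 * n + 1) + 2 * n + 1)))) * h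
  apply eq_of_forall_X_pow_dvd
  intro N
  have h1 := dvd_add (X_pow_dvd_shelfSeries_sub i (p + 1) 0 N)
    ((X_pow_dvd_shelfSeries_sub (i + 1) p 0 N).mul_left (PowerSeries.X ^ 1))
  have h2 := dvd_seriesSum_sub (fun n => X_pow_dvd_thetaTerm (2 * p + 1) (4 * i + 2 * p + 3) n
    (by omega) (by omega)) (le_refl N)
  refine (dvd_sub h1 h2).trans (dvd_of_eq ?_)
  rw [← Finset.sum_congr rfl fun n _ => hterm n, Finset.sum_add_distrib, ← Finset.mul_sum]
  unfold shelfCore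
  ring

/-- The `q`-expansion of the entries of the shelves, as power series. -/
noncomputable def shelfPS (i p j : ℕ) : PowerSeries ℂ := commonProd * shelfCore i p j

/-! ### Identification of the shelves with power series -/

theorem qPow_mul (m n : ℤ) : qPow m * qPow n = qPow (m + n) := by
  simp [qPow, HahnSeries.single_mul_single]

theorem qPow_zero : qPow 0 = 1 := rfl

theorem qPow_natCast (n : ℕ) :
    qPow n = (((PowerSeries.X : PowerSeries ℂ) ^ n : PowerSeries ℂ) : LaurentSeries ℂ) := by
  rw [qPow, PowerSeries.coe_pow, PowerSeries.coe_X, HahnSeries.single_pow]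
  simp

theorem qPow_ne_zero (n : ℤ) : qPow n ≠ 0 := by
  intro h
  have := qPow_mul n (-n)
  rw [h, zero_mul, add_neg_cancel, qPow_zero] at this
  exact zero_ne_one this

theorem shelf_eq_shelfPS (i p j : ℕ) :
    shelf (i + p + 1) j (i + 1) = (shelfPS i p j : LaurentSeries ℂ) := by
  induction j generalizing i p with
  | zero => rw [shelf, prodSide_eq, shelfPS, shelfCore_zero]
  | succ j ihj =>
    induction i generalizing p with
    | zero =>
      -- First position: it equals the last one of the previous shelf, since `shelfSeries (p + 1) 0
      -- j` vanishes.
      have h := shelfSeries_sub p 0 j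
      rw [shelfSeries_zero, sub_zero, mul_zero, pow_zero, one_mul] at h
      rw [zero_add, zero_add, shelf, show p + 1 = p + 0 + 1 by ring, ihj p 0, shelfPS, shelfPS, ← h,
        shelfCore, shelfSeries_zero, mul_zero, add_zero, zero_add]
    | succ i ihi =>
      have h1 := shelfSeries_sub p (i + 1) j
      have h2 := shelfSeries_sub (p + 1) i j
      rw [shelf, show i + 1 + p + 1 - (i + 2) + 1 = p + 1 by omega,
        show i + 1 + p + 1 - (i + 2) + 2 = (p + 1) + 1 by omega,
        show i + 1 + p + 1 = i + (p + 1) + 1 by ring, ihi (p + 1),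
        show i + (p + 1) + 1 = p + (i + 1) + 1 by ring, ihj p (i + 1),
        show p + (i + 1) + 1 = (p + 1) + i + 1 by ring, ihj (p + 1) i,
        sub_eq_iff_eq_add, div_eq_iff (qPow_ne_zero _)]
      -- The second exponent is 2(j+1)(i+1) - 1, one less than the power divided by: this is the
      -- source of the q⁻¹ in the recursion.
      have h3 : shelfPS p (i + 1) j - shelfPS (p + 1) i j =
          shelfPS (i + 1) p (j + 1) * PowerSeries.X ^ (2 * (j + 1) * (i + 1)) +
            PowerSeries.X ^ (2 * (j + 1) * i + (2 * j + 1)) * shelfPS i (p + 1) (j + 1) := by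
        unfold shelfPS
        rw [shelfCore.eq_1 p, shelfCore.eq_1 (p + 1)]
        linear_combination commonProd * h1 + commonProd * PowerSeries.X ^ (2 * j + 1) * h2
      rw [← PowerSeries.coe_sub, h3, PowerSeries.coe_add, PowerSeries.coe_mul, PowerSeries.coe_mul,
        ← qPow_natCast, ← qPow_natCast]
      have e2 : qPow (((2 * (j + 1) * i + (2 * j + 1) : ℕ) : ℤ)) =
          qPow (-1) * qPow (2 * ((j : ℤ) + 1) * ((i : ℤ) + 2 - 1)) := by
        rw [qPow_mul]
        congr 1
        push_cast
        ring
      have e3 : qPow (((2 * (j + 1) * (i + 1) : ℕ) : ℤ)) =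
          qPow (2 * ((j : ℤ) + 1) * ((i : ℤ) + 2 - 1)) := by
        congr 1
        push_cast
        ring
      push_cast at e2 e3 ⊢
      rw [e2, e3]
      ring

/-- The first entry of shelf j + 1 is `commonProd * shelfSeries p 1 j`. Modulo X^j only the term n =
0 survives, reducing to `pochRatio j 0`, which cancels the first j factors of `commonProd` except
for the extra denominator 1 + X^(2j+1). -/
theorem X_pow_dvd_shelfPS_sub_one (p j : ℕ) :
    (PowerSeries.X : PowerSeries ℂ) ^ j ∣ shelfPS 0 p (j + 1) - 1 := by
  have h := shelfSeries_sub p 0 j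
  rw [shelfSeries_zero, sub_zero, mul_zero, pow_zero, one_mul] at h
  have h1 : (PowerSeries.X : PowerSeries ℂ) ^ j ∣ shelfSeries p 1 j - shelfTerm p 1 j 0 := by
    have h2 := X_pow_dvd_shelfSeries_sub p 1 j (j + 1)
    rw [Finset.sum_range_succ'] at h2
    have h3 : (PowerSeries.X : PowerSeries ℂ) ^ j ∣
        ∑ n ∈ Finset.range j, shelfTerm p 1 j (n + 1) :=
      Finset.dvd_sum fun n _ => (pow_dvd_pow _ (((Nat.le_mul_of_pos_right j n.succ_pos).trans
        (Nat.le_add_left _ ((n + 1) ^ 2))).trans ((Nat.le_mul_of_pos_left _ (by omega)).trans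
        (Nat.le_add_right _ _)))).trans
        (X_pow_dvd_shelfTerm p 1 j (n + 1))
    have h4 := dvd_add ((pow_dvd_pow _ j.le_succ).trans h2) h3
    refine h4.trans (dvd_of_eq ?_)
    ring
  have h2 : (PowerSeries.X : PowerSeries ℂ) ^ j ∣ shelfTerm p 1 j 0 - pochRatio j 0 := by
    refine ⟨-PowerSeries.X ^ (j + 2) * pochRatio j 0, ?_⟩
    unfold shelfTerm
    ring
  have h3 := X_pow_dvd_commonProd_sub (le_refl j)
  have h4 : (∏ t ∈ Finset.range j, commonFactor t) * pochRatio j 0 =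
      (1 + PowerSeries.X ^ (2 * j + 1))⁻¹ := by
    unfold pochRatio
    rw [Finset.prod_range_succ, ← mul_assoc, ← mul_assoc, ← Finset.prod_mul_distrib,
      ← Finset.prod_mul_distrib, Finset.prod_eq_one, one_mul, zero_add]
    intro t _
    have i1 := one_sub_X_pow_mul_inv (2 * t + 1)
    have i2 := one_add_X_pow_mul_inv (2 * t)
    unfold commonFactor
    rw [zero_add]
    generalize (1 + (PowerSeries.X : PowerSeries ℂ) ^ (2 * t + 1))⁻¹ = u at *
    generalize (1 - (PowerSeries.X : PowerSeries ℂ) ^ (2 * t + 2))⁻¹ = v at *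
    linear_combination (1 + PowerSeries.X ^ (2 * t + 1)) * u * i1 + i2
  have h5 : (PowerSeries.X : PowerSeries ℂ) ^ j ∣ (1 + PowerSeries.X ^ (2 * j + 1))⁻¹ - 1 := by
    refine ⟨-PowerSeries.X ^ (j + 1) * (1 + PowerSeries.X ^ (2 * j + 1))⁻¹, ?_⟩
    have := one_add_X_pow_mul_inv (2 * j)
    linear_combination this
  rw [shelfPS, ← h]
  have h6 := dvd_mul_sub_mul h3 (dvd_sub_trans h1 h2)
  rw [h4] at h6
  exact dvd_sub_trans h6 h5

/-! ### The matrices -/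

theorem matB_sum (k j : ℕ) (r : Fin k) (f : ℕ → LaurentSeries ℂ) :
    ∑ c : Fin k, matB k j r c * f c =
      qPow (-(2 * j * (r : ℕ))) *
        (f (k - 1 - r) - if (r : ℕ) = 0 then 0 else f (k - r)) := by
  have hr := r.isLt
  have h : ∀ c : Fin k, matB k j r c * f c =
      (if (c : ℕ) = k - 1 - r then qPow (-(2 * j * (r : ℕ))) * f c else 0) +
        (if (c : ℕ) = k - r then -(qPow (-(2 * j * (r : ℕ))) * f c) else 0) := by
    intro c
    simp only [matB, Matrix.of_apply]
    by_cases h1 : (r : ℕ) + c + 1 = k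
    · rw [if_pos h1, if_pos (by omega), if_neg (by omega), add_zero]
    · rw [if_neg h1, if_neg (show ¬ (c : ℕ) = k - 1 - r by omega), zero_add]
      by_cases h2 : (r : ℕ) + c = k
      · rw [if_pos h2, if_pos (by omega)]
        ring
      · rw [if_neg h2, if_neg (by omega), zero_mul]
  rw [Finset.sum_congr rfl fun c _ => h c, Finset.sum_add_distrib,
    Fin.sum_univ_eq_sum_range (fun c => if c = k - 1 - r then qPow (-(2 * j * (r : ℕ))) * f c else 0),
    Fin.sum_univ_eq_sum_range (fun c => if c = k - r then -(qPow (-(2 * j * (r : ℕ))) * f c) else 0),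
    Finset.sum_ite_eq', Finset.sum_ite_eq', if_pos (Finset.mem_range.mpr (by omega))]
  by_cases h0 : (r : ℕ) = 0
  · rw [if_neg (by rw [Finset.mem_range]; omega), if_pos h0]
    ring
  · rw [if_pos (by rw [Finset.mem_range]; omega), if_neg h0]
    ring

theorem matC_sum (k : ℕ) (r : Fin k) (f : ℕ → LaurentSeries ℂ) :
    ∑ c : Fin k, matC k r c * f c =
      f r + if (r : ℕ) = 0 then 0 else qPow (-1) * f (r - 1) := by
  have hr := r.isLt
  have h : ∀ c : Fin k, matC k r c * f c =
      (if (c : ℕ) = r then f c else 0) +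
        (if (r : ℕ) = c + 1 then qPow (-1) * f c else 0) := by
    intro c
    simp only [matC, Matrix.of_apply]
    by_cases h1 : r = c
    · subst h1
      simp
    · rw [if_neg h1, if_neg (show ¬ (c : ℕ) = r from fun h => h1 (Fin.ext h.symm)), zero_add]
      split_ifs <;> simp
  rw [Finset.sum_congr rfl fun c _ => h c, Finset.sum_add_distrib,
    Fin.sum_univ_eq_sum_range (fun c => if c = (r : ℕ) then f c else 0),
    Fin.sum_univ_eq_sum_range (fun c => if (r : ℕ) = c + 1 then qPow (-1) * f c else 0),
    Finset.sum_ite_eq', if_pos (Finset.mem_range.mpr hr)]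
  congr 1
  by_cases h0 : (r : ℕ) = 0
  · rw [if_pos h0]
    exact Finset.sum_eq_zero fun c _ => if_neg (by omega)
  · rw [if_neg h0, Finset.sum_eq_single ((r : ℕ) - 1)]
    · rw [if_pos (by omega)]
    · intro c _ hc
      exact if_neg (by omega)
    · intro hc
      exact absurd (Finset.mem_range.mpr (by omega)) hc

/-- The inverse of `𝐁_(j)`. -/
noncomputable def matA (k j : ℕ) : Matrix (Fin k) (Fin k) (LaurentSeries ℂ) :=
  Matrix.of fun c s => if (c : ℕ) + s + 1 ≤ k then qPow (2 * j * (s : ℕ)) else 0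

/-- Up to a scalar, column s of `matA` is the indicator of c ≤ k - 1 - s, and row r of `matB`
measures the jump between c = k - 1 - r and c = k - r; the jump occurs there only for r = s. -/
theorem matB_mul_matA (k j : ℕ) : matB k j * matA k j = 1 := by
  ext1 r s
  have hr := r.isLt
  have hs := s.isLt
  have h := matB_sum k j r fun c => if c + s + 1 ≤ k then qPow (2 * j * (s : ℕ)) else 0
  rw [Matrix.mul_apply]
  refine h.trans ?_
  rw [Matrix.one_apply]
  by_cases h1 : r = s
  · subst h1
    rw [if_pos (by omega), if_pos rfl, if_neg (show ¬ k - (r : ℕ) + r + 1 ≤ k by omega), ite_self,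
      sub_zero, qPow_mul, neg_add_cancel, qPow_zero]
  · have h1' : (r : ℕ) ≠ s := fun h => h1 (Fin.ext h)
    rw [if_neg h1]
    by_cases h2 : (s : ℕ) < r
    · rw [if_pos (by omega), if_neg (by omega), if_pos (by omega), sub_self, mul_zero]
    · rw [if_neg (by omega), if_neg (show ¬ k - (r : ℕ) + s + 1 ≤ k by omega), ite_self, sub_self,
        mul_zero]

theorem isUnit_matB (k j : ℕ) : IsUnit (matB k j) :=
  IsUnit.of_mul_eq_one _ (matB_mul_matA k j)

theorem matB_inv (k j : ℕ) : (matB k j)⁻¹ = matA k j :=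
  Matrix.inv_eq_right_inv (matB_mul_matA k j)

theorem vecG_apply (k : ℕ) (hk : 2 ≤ k) (j : ℕ) (r : Fin k) :
    vecG k j r = shelf k j ((r : ℕ) + 1) :=
  G_eq_shelf k hk j _ (by omega) (by have := r.isLt; omega)

theorem matC_mulVec_vecG (k : ℕ) (hk : 2 ≤ k) (j : ℕ) :
    matC k *ᵥ vecG k (j + 1) = matB k (j + 1) *ᵥ vecG k j := by
  ext1 r
  have hr := r.isLt
  have hC := matC_sum k r fun c => shelf k (j + 1) (c + 1)
  have hB := matB_sum k (j + 1) r fun c => shelf k j (c + 1)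
  simp only [Matrix.mulVec, dotProduct, vecG_apply k hk]
  rw [hC, hB]
  rcases Nat.eq_zero_or_pos (r : ℕ) with h0 | h0
  · rw [if_pos h0, if_pos h0, h0, zero_add, shelf, Nat.sub_zero, show k - 1 + 1 = k by omega]
    simp [qPow_zero]
  · obtain ⟨i, hi⟩ : ∃ i, (r : ℕ) = i + 1 := ⟨(r : ℕ) - 1, by omega⟩
    rw [if_neg (by omega), if_neg (by omega), hi, shelf, show k - 1 - (i + 1) + 1 = k - (i + 2) + 1
      by omega, show k - (i + 1) + 1 = k - (i + 2) + 2 by omega, show i + 1 - 1 + 1 = i + 1 by omega,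
      sub_add_cancel, div_eq_iff (qPow_ne_zero _), mul_right_comm, qPow_mul]
    rw [show -(2 * ((j + 1 : ℕ) : ℤ) * ((i + 1 : ℕ) : ℤ)) +
      2 * ((j : ℤ) + 1) * ((i : ℤ) + 2 - 1) = 0 by push_cast; ring, qPow_zero, one_mul]

theorem matA'_mulVec_vecG (k : ℕ) (hk : 2 ≤ k) (j : ℕ) :
    matA' k (j + 1) *ᵥ vecG k (j + 1) = vecG k j := by
  rw [matA', matB_inv, ← Matrix.mulVec_mulVec, matC_mulVec_vecG k hk, Matrix.mulVec_mulVec,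
    mul_eq_one_comm.mp (matB_mul_matA k (j + 1)), Matrix.one_mulVec]

/-! ### Matrix products: nonnegativity and the coefficientwise limit -/

theorem range'_sub_succ (J j : ℕ) (h : J ≤ j) :
    List.range' (J + 1) (j + 1 - J) = List.range' (J + 1) (j - J) ++ [j + 1] := by
  rw [Nat.succ_sub h, Nat.succ_eq_add_one, List.range'_1_concat,
    show J + 1 + (j - J) = j + 1 by omega]

theorem matH_mulVec_vecG (k : ℕ) (hk : 2 ≤ k) (J j : ℕ) (h : J ≤ j) :
    vecG k J = matH k J j *ᵥ vecG k j := by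
  induction j, h using Nat.le_induction with
  | base => simp [matH]
  | succ j h ih =>
    rw [matH, range'_sub_succ J j h, List.map_append, List.prod_append, ← Matrix.mulVec_mulVec,
      List.map_singleton, List.prod_singleton, matA'_mulVec_vecG k hk]
    exact ih

/-- The matrix `𝐀'_(j)`, as a matrix of polynomials. -/
noncomputable def polyA' (k j : ℕ) : Matrix (Fin k) (Fin k) ℕ[X] :=
  Matrix.of fun c s =>
    (if (c : ℕ) + s + 1 ≤ k then Polynomial.X ^ (2 * j * s) else 0) +
      if (c : ℕ) + s + 2 ≤ k then Polynomial.X ^ (2 * j * s + (2 * j - 1)) else 0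

/-- A polynomial with natural coefficients, viewed as a formal power series. -/
noncomputable def natPolyToPowerSeries : ℕ[X] →+* PowerSeries ℂ :=
  (Polynomial.coeToPowerSeries.ringHom).comp (Polynomial.mapRingHom (Nat.castRingHom ℂ))

/-- The ring homomorphism underlying `natPolyToLaurent`. -/
noncomputable def natPolyToLaurentHom : ℕ[X] →+* LaurentSeries ℂ :=
  (HahnSeries.ofPowerSeries ℤ ℂ).comp natPolyToPowerSeries

theorem natPolyToPowerSeries_X_pow (n : ℕ) :
    natPolyToPowerSeries (Polynomial.X ^ n) = PowerSeries.X ^ n := by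
  simp [natPolyToPowerSeries]

theorem natPolyToLaurentHom_X_pow (n : ℕ) :
    natPolyToLaurentHom (Polynomial.X ^ n) = qPow n := by
  rw [natPolyToLaurentHom, RingHom.comp_apply, natPolyToPowerSeries_X_pow, qPow_natCast]

/-- Column s of the product is column s of `matA` plus q⁻¹ times column s + 1, whose factor
q^(2j(s+1)) absorbs the q⁻¹ as soon as j ≥ 1. -/
theorem matA'_eq (k j : ℕ) (hj : 1 ≤ j) :
    matA' k j = natPolyToLaurentHom.mapMatrix (polyA' k j) := by
  suffices h : matB k j * natPolyToLaurentHom.mapMatrix (polyA' k j) = matC k by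
    rw [matA', ← h, matB_inv, ← mul_assoc, mul_eq_one_comm.mp (matB_mul_matA k j), one_mul]
  ext1 r s
  have hr := r.isLt
  have hs := s.isLt
  have h := matB_sum k j r fun c => (if c + s + 1 ≤ k then qPow (2 * j * s : ℕ) else 0) +
      if c + s + 2 ≤ k then qPow (2 * j * s + (2 * j - 1) : ℕ) else 0
  have h' : ∀ c, natPolyToLaurentHom.mapMatrix (polyA' k j) c s =
      (if (c : ℕ) + s + 1 ≤ k then qPow (2 * j * s : ℕ) else 0) +
      if (c : ℕ) + s + 2 ≤ k then qPow (2 * j * s + (2 * j - 1) : ℕ) else 0 := by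
    intro c
    rw [RingHom.mapMatrix_apply, Matrix.map_apply, polyA', Matrix.of_apply, map_add,
      apply_ite natPolyToLaurentHom, apply_ite natPolyToLaurentHom, map_zero,
      natPolyToLaurentHom_X_pow, natPolyToLaurentHom_X_pow]
  rw [Matrix.mul_apply, Finset.sum_congr rfl fun c _ => by rw [h' c]]
  refine h.trans ?_
  rw [matC, Matrix.of_apply]
  by_cases h1 : r = s
  · subst h1
    rw [if_pos (by omega), if_neg (by omega), if_pos rfl,
      if_neg (show ¬ k - (r : ℕ) + r + 1 ≤ k by omega),
      if_neg (show ¬ k - (r : ℕ) + r + 2 ≤ k by omega), add_zero, add_zero, ite_self, sub_zero,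
      qPow_mul, ← qPow_zero]
    congr 1
    push_cast
    ring
  · have h1' : (r : ℕ) ≠ s := fun h => h1 (Fin.ext h)
    rw [if_neg h1]
    by_cases h2 : (s : ℕ) < r
    · rw [if_pos (by omega), if_pos (by omega), if_neg (by omega), if_pos (by omega)]
      by_cases h3 : (r : ℕ) = s + 1
      · rw [if_neg (by omega), if_pos h3, add_zero, add_sub_cancel_left, qPow_mul, h3]
        congr 1
        push_cast [Nat.cast_sub (show 1 ≤ 2 * j by omega)]
        ring
      · rw [if_pos (by omega), if_neg h3, sub_self, mul_zero]
    · rw [if_neg (by omega), if_neg (by omega), if_neg (show ¬ k - (r : ℕ) + s + 1 ≤ k by omega),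
        if_neg (show ¬ k - (r : ℕ) + s + 2 ≤ k by omega), add_zero, ite_self, sub_self, mul_zero,
        if_neg (by omega)]

/-- The matrix `ᴶ𝐡^(j)`, as a matrix of polynomials. -/
noncomputable def polyH (k J j : ℕ) : Matrix (Fin k) (Fin k) ℕ[X] :=
  ((List.range' (J + 1) (j - J)).map (polyA' k)).prod

theorem matH_eq (k J j : ℕ) : matH k J j = natPolyToLaurentHom.mapMatrix (polyH k J j) := by
  rw [matH, polyH, map_list_prod, List.map_map]
  congr 1
  refine List.map_congr_left fun m hm => matA'_eq k m ?_
  have := List.mem_range'_1.mp hm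
  omega

theorem matH_apply (k J j : ℕ) (i l : Fin k) :
    matH k J j i l = (natPolyToPowerSeries (polyH k J j i l) : LaurentSeries ℂ) := by
  rw [matH_eq]
  rfl

/-- The last factor alone decides: column l of A'_(j+1) already has this divisibility, and left
multiplication preserves it. -/
theorem X_pow_dvd_polyH (k J j : ℕ) (h : J ≤ j) (i l : Fin k) :
    (Polynomial.X : ℕ[X]) ^ (2 * (j + 1) * l) ∣ polyH k J (j + 1) i l := by
  rw [polyH, range'_sub_succ J j h, List.map_append, List.prod_append, List.map_singleton,
    List.prod_singleton, Matrix.mul_apply]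
  refine Finset.dvd_sum fun c _ => Dvd.dvd.mul_left ?_ _
  rw [polyA', Matrix.of_apply]
  refine dvd_add ?_ ?_ <;> split_ifs
  · exact dvd_rfl
  · exact dvd_zero _
  · exact pow_dvd_pow _ (Nat.le_add_right _ _)
  · exact dvd_zero _

theorem vecG_eq_shelfPS (k : ℕ) (hk : 2 ≤ k) (j : ℕ) (r : Fin k) :
    vecG k j r = (shelfPS r (k - 1 - r) j : LaurentSeries ℂ) := by
  rw [vecG_apply k hk, ← shelf_eq_shelfPS]
  congr 1
  have := r.isLt
  omega

/-- The vector identity is pulled back to power series, because X is a unit among Laurent series and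
divisibility by X^N would say nothing there. -/
theorem shelfPS_eq_sum (k : ℕ) (hk : 2 ≤ k) (J j : ℕ) (h : J ≤ j) (i : Fin k) :
    shelfPS i (k - 1 - i) J =
      ∑ l : Fin k, natPolyToPowerSeries (polyH k J j i l) * shelfPS l (k - 1 - l) j := by
  apply HahnSeries.ofPowerSeries_injective (Γ := ℤ)
  have h1 := congrFun (matH_mulVec_vecG k hk J j h) i
  simp only [Matrix.mulVec, dotProduct, vecG_eq_shelfPS k hk, matH_apply] at h1
  rw [h1, map_sum]
  exact Finset.sum_congr rfl fun l _ => (map_mul _ _ _).symm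

theorem X_pow_dvd_polyH_zero_sub (k : ℕ) (hk : 2 ≤ k) (J j : ℕ) (h : J ≤ j) (i : Fin k) :
    (PowerSeries.X : PowerSeries ℂ) ^ j ∣
      natPolyToPowerSeries (polyH k J (j + 1) i ⟨0, by omega⟩) - shelfPS i (k - 1 - i) J := by
  rw [shelfPS_eq_sum k hk J (j + 1) (by omega) i,
    ← Finset.add_sum_erase _ _ (Finset.mem_univ (⟨0, by omega⟩ : Fin k)), ← sub_sub]
  refine dvd_sub ?_ (Finset.dvd_sum fun l hl => Dvd.dvd.mul_right ?_ _)
  · have h1 := (dvd_sub_symm (X_pow_dvd_shelfPS_sub_one (k - 1) j)).mul_left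
      (natPolyToPowerSeries (polyH k J (j + 1) i ⟨0, by omega⟩))
    rwa [mul_sub, mul_one] at h1
  · have h1 := map_dvd natPolyToPowerSeries (X_pow_dvd_polyH k J j h i l)
    rw [natPolyToPowerSeries_X_pow] at h1
    refine (pow_dvd_pow _ ?_).trans h1
    have hl0 : (l : ℕ) ≠ 0 := fun h0 => (Finset.mem_erase.mp hl).1 (Fin.ext h0)
    have : j + 1 ≤ (j + 1) * l := Nat.le_mul_of_pos_right _ (by omega)
    rw [mul_assoc]
    omega

theorem isCoeffLimit_of_X_pow_dvd {H : ℕ → LaurentSeries ℂ} {u : ℕ → PowerSeries ℂ}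
    {L : PowerSeries ℂ} (hu : ∀ j, H j = (u j : LaurentSeries ℂ)) {J : ℕ}
    (h : ∀ j, J ≤ j → (PowerSeries.X : PowerSeries ℂ) ^ j ∣ u (j + 1) - L) :
    IsCoeffLimit H (L : LaurentSeries ℂ) := by
  intro n
  -- After the shift j = m + 1 this bound gives both m ≥ J and m > |n|; coefficients of negative
  -- index vanish on both sides.
  refine ⟨J + n.natAbs + 2, fun j hj => ?_⟩
  obtain ⟨j, rfl⟩ : ∃ m, j = m + 1 := ⟨j - 1, by omega⟩
  rw [hu, PowerSeries.coeff_coe, PowerSeries.coeff_coe]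
  split_ifs
  · rfl
  · have := PowerSeries.X_pow_dvd_iff.mp (h j (by omega)) n.natAbs (by omega)
    rwa [map_sub, sub_eq_zero] at this

end GollnitzGordonAndrews

theorem mainTheorem4 (k : ℕ) (hk : 2 ≤ k) :
    (∀ j : ℕ, 1 ≤ j → IsUnit (GollnitzGordonAndrews.matB k j)) ∧
    (∀ j : ℕ, 1 ≤ j →
      GollnitzGordonAndrews.matC k *ᵥ GollnitzGordonAndrews.vecG k j =
        GollnitzGordonAndrews.matB k j *ᵥ GollnitzGordonAndrews.vecG k (j - 1)) ∧
    ∀ J : ℕ,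
      (∀ j : ℕ, J ≤ j →
        GollnitzGordonAndrews.vecG k J =
          GollnitzGordonAndrews.matH k J j *ᵥ GollnitzGordonAndrews.vecG k j) ∧
      (∀ j : ℕ, J ≤ j → ∀ i l : Fin k, ∃ p : ℕ[X],
        GollnitzGordonAndrews.matH k J j i l = GollnitzGordonAndrews.natPolyToLaurent p) ∧
      (∀ i : Fin k, ∃ hInf : PowerSeries ℂ,
        GollnitzGordonAndrews.IsCoeffLimit
          (fun j => GollnitzGordonAndrews.matH k J j i ⟨0, by omega⟩)
          (hInf : LaurentSeries ℂ) ∧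
        GollnitzGordonAndrews.G k ((k - 1) * J + (i + 1)) = (hInf : LaurentSeries ℂ)) := by
  refine ⟨fun j _ => GollnitzGordonAndrews.isUnit_matB k j, fun j hj => ?_, fun J => ⟨?_, ?_, ?_⟩⟩
  · obtain ⟨j, rfl⟩ : ∃ m, j = m + 1 := ⟨j - 1, by omega⟩
    exact GollnitzGordonAndrews.matC_mulVec_vecG k hk j
  · exact GollnitzGordonAndrews.matH_mulVec_vecG k hk J
  · exact fun j _ i l => ⟨GollnitzGordonAndrews.polyH k J j i l,
      GollnitzGordonAndrews.matH_apply k J j i l⟩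
  · exact fun i => ⟨GollnitzGordonAndrews.shelfPS i (k - 1 - i) J,
      GollnitzGordonAndrews.isCoeffLimit_of_X_pow_dvd
        (fun j => GollnitzGordonAndrews.matH_apply k J j i ⟨0, by omega⟩)
        (GollnitzGordonAndrews.X_pow_dvd_polyH_zero_sub k hk J · · i),
      GollnitzGordonAndrews.vecG_eq_shelfPS k hk J i⟩
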